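/- **Setting.** Let $H$ be a complex Banach space (for instance a Hilbert space) and let $X$ be a bounded operator on $H$. A *spectral decomposition* of $X$ consists of * a resolution of the identity $E$ of $X$ on $\sigma(X)$ in the sense of Dunford: a projection-valued, strongly countably additive measure on the Borel subsets of $\sigma(X)$ with $E(\sigma(X))=I$ and $E(A\cap B)=E(A)E(B)$, whose values are (not necessarily orthogonal) projections commuting with $X$ such that $\sigma\big(X|_{E(\delta)H}\big)\subseteq\overline{\delta}$ for every Borel set $\delta\subseteq\sigma(X)$; * a Borel function $\lambda\mapsto m_\lambda\in\mathbb N$ on $\sigma(X)$ (not assumed bounded) such that $(X-\lambda I)\,dE(\lambda)$ is nilpotent of order $m_\lambda$, i.e. $X_N^{\,q}\,E(\{\lambda: m_\lambda\le q\})=0$ for every $q\ge 0$, where $$X_P=\int_{\sigma(X)}\lambda\,dE(\lambda),\qquad X_N=\int_{\sigma(X)}(X-\lambda I)\,dE(\lambda).$$ All operator integrals are operator-norm limits of Riemann sums over finite tagged Borel partitions of the spectrum, directed by refinement (for double integrals: pairs of such partitions, of $\sigma(X_1)$ and of $\sigma(X_2)$); in these sums $(X-\lambda I)^q\,dE(\lambda)$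 becomes $(X-\xi I)^qE(A)$ for a cell $A$ with tag $\xi\in A$. Let $X_1,X_2$ be bounded operators on $H$ with spectral decompositions $(E_1,m)$ and $(E_2,m)$. For $\beta(z_1,z_2)$ and a bounded operator $Y$ put, with $\beta^{(q_1,q_2)}=\partial_{z_1}^{q_1}\partial_{z_2}^{q_2}\beta$, $$T_\beta^{X_{1,a},X_{2,b}}(Y)=\int_{\sigma(X_1)}\int_{\sigma(X_2)}\ \sum_{q_1\in Q_a(\lambda_1)}\ \sum_{q_2\in Q_b(\lambda_2)}\frac{\beta^{(q_1,q_2)}(\lambda_1,\lambda_2)}{q_1!\,q_2!}\,(X_1-\lambda_1I)^{q_1}dE_1(\lambda_1)\,Y\,(X_2-\lambda_2I)^{q_2}dE_2(\lambda_2)$$ for $a,b\in\{P,N\}$, where $Q_P(\lambda)=\{0\}$ and $Q_N(\lambda)=\{1,\dots,m_\lambda-1\}$. Thus $T_\beta^{X_{1,P},X_{2,P}}(Y)=\iint\beta\,dE_1\,Y\,dE_2$ is the classical double operator integral, and the generalized double operator integral is $$T_\beta^{X_1,X_2}(Y)=T_\beta^{X_{1,P},X_{2,P}}(Y)+T_\beta^{X_{1,P},X_{2,N}}(Y)+T_\beta^{X_{1,N},X_{2,P}}(Y)+T_\beta^{X_{1,N},X_{2,N}}(Y).$$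 **Theorem.** Let $f$ be analytic on $\{|z|<R\}$. Let $X_1,X_2$ be bounded operators on $H$ with spectral decompositions as above, with $\sigma(X_1),\sigma(X_2)\subseteq\{|z|<R\}$, and assume $\lambda_1\ne\lambda_2$ for all $\lambda_1\in\sigma(X_1)$, $\lambda_2\in\sigma(X_2)$. Put $f^{[1]}(x_1,x_2)=\frac{f(x_1)-f(x_2)}{x_1-x_2}$. Then the integrals defining $X_{i,P}$ and $X_{i,N}$ converge and $X_i=X_{i,P}+X_{i,N}$ for $i=1,2$; all the double operator integrals below (for the left-hand side, each of its four parts) converge in operator norm; and $$T_{f^{[1]}}^{X_1,X_2}(X_1-X_2)=T_{f^{[1]}}^{X_{1,P},X_{2,P}}(X_{1,P}-X_{2,P})+\Big[T_{f(x_1)}^{X_{1,N},X_{2,P}}(I)-T_{f(x_2)}^{X_{1,P},X_{2,N}}(I)\Big].$$ -/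

import Mathlib

open Filter Topology

/-- A spectral measure on a measurable space `Ω` with values in the bounded operators on `H`:
a multiplicative, strongly countably additive family of (not necessarily orthogonal) projections
with total mass the identity. Only its values on measurable sets matter. -/
structure SpectralMeasure (Ω : Type*) [MeasurableSpace Ω] (H : Type*) [NormedAddCommGroup H]
    [NormedSpace ℂ H] where
  proj : Set Ω → (H →L[ℂ] H)
  proj_univ : proj Set.univ = 1
  proj_inter : ∀ A B : Set Ω, MeasurableSet A → MeasurableSet B →
    proj (A ∩ B) = proj A * proj B
  proj_iUnion : ∀ A : ℕ → Set Ω, (∀ n, MeasurableSet (A n)) →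
    Pairwise (fun i j => Disjoint (A i) (A j)) →
    ∀ x : H, HasSum (fun n => proj (A n) x) (proj (⋃ n, A n) x)

/-- A finite measurable partition of `Ω` with a tag in each cell, encoded by the map that sends a
point to the tag of its cell: the cells are the (nonempty) fibres, and `tag_tag` says that each tag
lies in its own cell. -/
structure TaggedPartition (Ω : Type*) [MeasurableSpace Ω] where
  tag : MeasureTheory.SimpleFunc Ω Ω
  tag_tag : ∀ x, tag (tag x) = tag x

namespace TaggedPartition

variable {Ω : Type*} [MeasurableSpace Ω]

/-- The finite set of tags. -/
noncomputable def tags (p : TaggedPartition Ω) : Finset Ω := p.tag.range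

/-- The cell with tag `ξ`. -/
def cell (p : TaggedPartition Ω) (ξ : Ω) : Set Ω := p.tag ⁻¹' {ξ}

/-- `p ≤ p'` when `p'` is finer than `p`: points in the same cell of `p'` are in the same cell of
`p`. The tags are not compared. -/
instance : Preorder (TaggedPartition Ω) where
  le p p' := ∀ x y, p'.tag x = p'.tag y → p.tag x = p.tag y
  le_refl _ _ _ h := h
  le_trans _ _ _ h₁ h₂ x y h := h₁ x y (h₂ x y h)

instance : Nonempty (TaggedPartition Ω) := by
  rcases isEmpty_or_nonempty Ω with h | ⟨⟨x₀⟩⟩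
  · exact ⟨⟨⟨fun x => x, fun x => (h.false x).elim, Set.toFinite _⟩, fun x => (h.false x).elim⟩⟩
  · exact ⟨⟨MeasureTheory.SimpleFunc.const Ω x₀, fun x => rfl⟩⟩

/-- Any two tagged partitions have a common refinement. -/
instance : IsDirectedOrder (TaggedPartition Ω) := by
  classical
  refine ⟨fun p p' => ?_⟩
  let c : Ω × Ω → Ω := fun w => if h : ∃ y, (p.tag y, p'.tag y) = w then h.choose else w.1
  have hc : ∀ x, (p.tag (c (p.tag x, p'.tag x)), p'.tag (c (p.tag x, p'.tag x)))
      = (p.tag x, p'.tag x) := by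
    intro x
    have h : ∃ y, (p.tag y, p'.tag y) = (p.tag x, p'.tag x) := ⟨x, rfl⟩
    have e : c (p.tag x, p'.tag x) = h.choose := dif_pos h
    rw [e]
    exact h.choose_spec
  have key : ∀ x y, c (p.tag x, p'.tag x) = c (p.tag y, p'.tag y) →
      (p.tag x, p'.tag x) = (p.tag y, p'.tag y) := by
    intro x y h
    rw [← hc x, ← hc y, h]
  refine ⟨⟨(p.tag.pair p'.tag).map c, fun x => ?_⟩, ?_, ?_⟩
  · change c (p.tag (c (p.tag x, p'.tag x)), p'.tag (c (p.tag x, p'.tag x))) = _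
    rw [hc x]
    rfl
  · exact fun x y h => (Prod.ext_iff.1 (key x y h)).1
  · exact fun x y h => (Prod.ext_iff.1 (key x y h)).2

end TaggedPartition

section SpectralOperators

variable {H : Type*} [NormedAddCommGroup H] [NormedSpace ℂ H]

/-- The Riemann sum of `∫ G(λ) dE(λ)` for an operator-valued integrand `G`. -/
noncomputable def SpectralMeasure.riemannSum {Ω : Type*} [MeasurableSpace Ω]
    (E : SpectralMeasure Ω H) (G : Ω → (H →L[ℂ] H)) (p : TaggedPartition Ω) : H →L[ℂ] H :=
  ∑ ξ ∈ p.tags, G ξ * E.proj (p.cell ξ)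

/-- `∫ G(λ) dE(λ)` converges: the Riemann sums have a limit in operator norm along refinement. -/
def SpectralMeasure.Integrable {Ω : Type*} [MeasurableSpace Ω]
    (E : SpectralMeasure Ω H) (G : Ω → (H →L[ℂ] H)) : Prop :=
  ∃ A, Tendsto (E.riemannSum G) atTop (𝓝 A)

/-- `∫ G(λ) dE(λ)`, the limit of the Riemann sums. -/
noncomputable def SpectralMeasure.integral {Ω : Type*} [MeasurableSpace Ω]
    (E : SpectralMeasure Ω H) (G : Ω → (H →L[ℂ] H)) : H →L[ℂ] H :=
  limUnder atTop (E.riemannSum G)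

/-- The restriction of `X` to the range of an operator `P` that commutes with it. -/
noncomputable def restrictRange (X P : H →L[ℂ] H) (h : Commute X P) :
    LinearMap.range P.toLinearMap →L[ℂ] LinearMap.range P.toLinearMap :=
  (X.comp (LinearMap.range P.toLinearMap).subtypeL).codRestrict _ (by
    rintro ⟨_, y, rfl⟩
    exact ⟨X y, (DFunLike.congr_fun h.eq y).symm⟩)

/-- A spectral decomposition of the bounded operator `X`: a resolution of the identity `E` of `X`
on `σ(X)`, in the sense of Dunford, together with a (finite, not necessarily bounded) order
function `order`, `λ ↦ m_λ`, for which `(X - λ I) dE(λ)` is nilpotent of order `m_λ`: the part of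
`(∫ (X - λ I) dE(λ)) ^ q` on `{λ | m_λ ≤ q}` vanishes for each `q`. -/
structure SpectralDecomposition (X : H →L[ℂ] H) where
  E : SpectralMeasure (spectrum ℂ X) H
  commute : ∀ δ : Set (spectrum ℂ X), MeasurableSet δ → Commute X (E.proj δ)
  spectrum_restrict : ∀ (δ : Set (spectrum ℂ X)) (hδ : MeasurableSet δ),
    spectrum ℂ (restrictRange X (E.proj δ) (commute δ hδ)) ⊆ closure (Subtype.val '' δ)
  order : spectrum ℂ X → ℕ
  measurable_order : Measurable order
  pow_order : ∀ q : ℕ,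
    (E.integral fun z => X - (z : ℂ) • (1 : H →L[ℂ] H)) ^ q * E.proj {z | order z ≤ q} = 0

namespace SpectralDecomposition

/-- The projection part `X_P = ∫ λ dE(λ)`. -/
noncomputable def projPart {X : H →L[ℂ] H} (D : SpectralDecomposition X) : H →L[ℂ] H :=
  D.E.integral fun z => (z : ℂ) • (1 : H →L[ℂ] H)

/-- The nilpotent part `X_N = ∫ (X - λ I) dE(λ)`. -/
noncomputable def nilPart {X : H →L[ℂ] H} (D : SpectralDecomposition X) : H →L[ℂ] H :=
  D.E.integral fun z => X - (z : ℂ) • (1 : H →L[ℂ] H)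

/-- `(X - ξ I) ^ q E(A)`, with `A` the cell of `p` with tag `ξ`: the discretization of
`(X - λ I) ^ q dE(λ)`. -/
noncomputable def weight {X : H →L[ℂ] H} (D : SpectralDecomposition X)
    (p : TaggedPartition (spectrum ℂ X)) (ξ : spectrum ℂ X) (q : ℕ) : H →L[ℂ] H :=
  (X - (ξ : ℂ) • (1 : H →L[ℂ] H)) ^ q * D.E.proj (p.cell ξ)

end SpectralDecomposition

/-- The mixed partial derivative `β^{(q₁,q₂)}(z₁, z₂)`. -/
noncomputable def mixedDeriv (β : ℂ → ℂ → ℂ) (q₁ q₂ : ℕ) (z₁ z₂ : ℂ) : ℂ :=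
  iteratedDeriv q₁ (fun w₁ => iteratedDeriv q₂ (fun w₂ => β w₁ w₂) z₂) z₁

/-- A general Riemann sum for the double operator integral whose integrand is
`∑_{q₁ ∈ s₁(λ₁)} ∑_{q₂ ∈ s₂(λ₂)} β^{(q₁,q₂)}(λ₁,λ₂) / (q₁! q₂!)
  (X₁ - λ₁ I)^{q₁} dE₁(λ₁) Y (X₂ - λ₂ I)^{q₂} dE₂(λ₂)`. -/
noncomputable def doubleSum {X₁ X₂ : H →L[ℂ] H} (D₁ : SpectralDecomposition X₁)
    (D₂ : SpectralDecomposition X₂) (s₁ : spectrum ℂ X₁ → Finset ℕ)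
    (s₂ : spectrum ℂ X₂ → Finset ℕ) (β : ℂ → ℂ → ℂ) (Y : H →L[ℂ] H)
    (p : TaggedPartition (spectrum ℂ X₁) × TaggedPartition (spectrum ℂ X₂)) : H →L[ℂ] H :=
  ∑ ξ₁ ∈ p.1.tags, ∑ ξ₂ ∈ p.2.tags, ∑ q₁ ∈ s₁ ξ₁, ∑ q₂ ∈ s₂ ξ₂,
    (mixedDeriv β q₁ q₂ ξ₁ ξ₂ / ((q₁.factorial : ℂ) * (q₂.factorial : ℂ))) •
      (D₁.weight p.1 ξ₁ q₁ * Y * D₂.weight p.2 ξ₂ q₂)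

/-- Which part of an operator enters a double operator integral: the projection part or the
nilpotent part. -/
inductive SpectralPart where
  | P
  | N

/-- The exponents `q` of `(X - λ I) ^ q` that belong to a part: `q = 0` for the projection part,
`1 ≤ q ≤ m_λ - 1` for the nilpotent part. -/
def SpectralDecomposition.exponents {X : H →L[ℂ] H} (D : SpectralDecomposition X) (a : SpectralPart)
    (z : spectrum ℂ X) : Finset ℕ :=
  match a with
  | SpectralPart.P => {0}
  | SpectralPart.N => Finset.Ico 1 (D.order z)

/-- The integral `T_β^{X_{1,a}, X_{2,b}}(Y)`, for `a, b ∈ {P, N}`, converges in operator norm. -/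
def PartDOIConverges {X₁ X₂ : H →L[ℂ] H} (D₁ : SpectralDecomposition X₁)
    (D₂ : SpectralDecomposition X₂) (a b : SpectralPart) (β : ℂ → ℂ → ℂ) (Y : H →L[ℂ] H) : Prop :=
  ∃ A, Tendsto (doubleSum D₁ D₂ (D₁.exponents a) (D₂.exponents b) β Y) atTop (𝓝 A)

/-- `T_β^{X_{1,a}, X_{2,b}}(Y)` for `a, b ∈ {P, N}`. For `a = b = P` this is the classical double
operator integral `∫∫ β(λ₁,λ₂) dE₁(λ₁) Y dE₂(λ₂)`. -/
noncomputable def partDOI {X₁ X₂ : H →L[ℂ] H} (D₁ : SpectralDecomposition X₁)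
    (D₂ : SpectralDecomposition X₂) (a b : SpectralPart) (β : ℂ → ℂ → ℂ) (Y : H →L[ℂ] H) : H →L[ℂ] H :=
  limUnder atTop (doubleSum D₁ D₂ (D₁.exponents a) (D₂.exponents b) β Y)

/-- The four integrals in the generalized double operator integral converge. -/
def GDOIConverges {X₁ X₂ : H →L[ℂ] H} (D₁ : SpectralDecomposition X₁)
    (D₂ : SpectralDecomposition X₂) (β : ℂ → ℂ → ℂ) (Y : H →L[ℂ] H) : Prop :=
  ∀ a b : SpectralPart, PartDOIConverges D₁ D₂ a b β Y

/-- The generalized double operator integral `T_β^{X₁, X₂}(Y)`. -/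
noncomputable def gdoi {X₁ X₂ : H →L[ℂ] H} (D₁ : SpectralDecomposition X₁)
    (D₂ : SpectralDecomposition X₂) (β : ℂ → ℂ → ℂ) (Y : H →L[ℂ] H) : H →L[ℂ] H :=
  partDOI D₁ D₂ SpectralPart.P SpectralPart.P β Y + partDOI D₁ D₂ SpectralPart.P SpectralPart.N β Y
    + partDOI D₁ D₂ SpectralPart.N SpectralPart.P β Y + partDOI D₁ D₂ SpectralPart.N SpectralPart.N β Y

/-- The first divided difference `f^{[1]}`. -/
noncomputable def dividedDiff (f : ℂ → ℂ) (z₁ z₂ : ℂ) : ℂ := (f z₁ - f z₂) / (z₁ - z₂)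

end SpectralOperators

/-!
Write `S = X_P = ∫ λ dE` and `N = X_N = X - S`. A spectral measure is uniformly bounded (vector
measures are bounded, and Banach-Steinhaus applies), so `g ↦ ∫ g dE` is a bounded algebra
homomorphism on bounded measurable functions; this gives the integrals for `S` and `N`.

The operator `N` is quasinilpotent (`SpectralDecomposition.exists_norm_nilPart_pow_le`): on a small
cell with tag `ξ` the spectral condition on restrictions and Gelfand's formula make the powers of
`X - ξ` small, those of `S - ξ` are small anyway, and `N` is their difference. Hence for a function
`φ` holomorphic near the spectrum, `φ(X) = ∑_q N^q ∫ φ^{(q)} / q! dE` converges and defines a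
multiplicative calculus, whatever the order function is. Expanding `(X - ξ)^q` in powers of `N` and
`S - ξ` shows that the single Riemann sums `∑_ξ ∑_q φ^{(q)}(ξ) / q! (X - ξ)^q E(A_ξ)` with exponents
`1 ≤ q < m_ξ` tend to `φ(X) - φ(S)`: the cutoff at `m_ξ` is invisible in the limit since `N^q`
vanishes on `{λ | m_λ ≤ q}`. Moreover these sums are bounded in terms of a bound of `φ`, uniformly
over fine partitions (`SpectralDecomposition.tendsto_partSum`, `exists_norm_partSum_le`).

A double operator integral whose integrand `β` is an absolutely convergent sum of products of
functions of one variable is therefore the sum of the products of single limits, by dominated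
convergence (`tendsto_doubleSum`). The divided difference is of this kind: for `x₁` close to a tag
`a`, as `|x₁ - a|` is less than `|x₂ - a|`,
`f^{[1]}(x₁, x₂) = -∑_n (f(x₁) - f(x₂)) (x₁ - a)^n (x₂ - a)^(-(n + 1))`.

Let `Y = X₁ - X₂ = (X₁ - a) - (X₂ - a)`. The series `∑_n (X₁ - a)^n E(A_a) Y (X₂ - a)^(-(n + 1))`
telescopes to `-E(A_a)`, and summation over `a` gives `T_{f^{[1]}}^{X₁, X₂}(X₁ - X₂) = f(X₁) - f(X₂)`.
The same computation with `N₁` and `N₂` replaced by `0` gives `f(S₁) - f(S₂)` for the projection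
parts, and the two integrals in the bracket are `f(X₁) - f(S₁)` and `f(X₂) - f(S₂)`.
-/

/-! ### Tagged partitions -/

namespace TaggedPartition

variable {Ω : Type*} [MeasurableSpace Ω]

lemma mem_tags {p : TaggedPartition Ω} {ξ : Ω} : ξ ∈ p.tags ↔ p.tag ξ = ξ := by
  rw [tags, MeasureTheory.SimpleFunc.mem_range]
  exact ⟨fun ⟨x, hx⟩ => by rw [← hx, p.tag_tag], fun h => ⟨ξ, h⟩⟩

lemma tag_mem_tags (p : TaggedPartition Ω) (x : Ω) : p.tag x ∈ p.tags := mem_tags.2 (p.tag_tag x)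

lemma measurableSet_cell (p : TaggedPartition Ω) (ξ : Ω) : MeasurableSet (p.cell ξ) :=
  p.tag.measurableSet_fiber ξ

lemma tag_tag_of_le {p p' : TaggedPartition Ω} (h : p ≤ p') (x : Ω) :
    p.tag (p'.tag x) = p.tag x := h _ _ (p'.tag_tag x)

/-- Every simple function is constant on the cells of some tagged partition. -/
lemma exists_tag_eq_imp {β : Type*} (s : MeasureTheory.SimpleFunc Ω β) :
    ∃ p : TaggedPartition Ω, ∀ x y, p.tag x = p.tag y → s x = s y := by
  classical
  rcases isEmpty_or_nonempty Ω with h | ⟨⟨x₀⟩⟩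
  · exact ⟨Classical.arbitrary _, fun x => (h.false x).elim⟩
  -- `c` chooses a point in each fibre of `s`.
  let c : β → Ω := fun b => if h : ∃ y, s y = b then h.choose else x₀
  have hc : ∀ x, s (c (s x)) = s x := by
    intro x
    have h : ∃ y, s y = s x := ⟨x, rfl⟩
    have e : c (s x) = h.choose := dif_pos h
    rw [e]
    exact h.choose_spec
  refine ⟨⟨s.map c, fun x => congrArg c (hc x)⟩, fun x y h => ?_⟩
  rw [← hc x, ← hc y]
  exact congrArg s h

end TaggedPartition

/-! ### Bounded measurable functions -/

/-- Bounded measurable complex functions: the integrands of the scalar functional calculus of a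
spectral measure. -/
structure BoundedMeasurable {Ω : Type*} [MeasurableSpace Ω] (g : Ω → ℂ) : Prop where
  measurable : Measurable g
  bounded : ∃ M, ∀ x, ‖g x‖ ≤ M

namespace BoundedMeasurable

variable {Ω : Type*} [MeasurableSpace Ω] {g h : Ω → ℂ}

lemma const (c : ℂ) : BoundedMeasurable (fun _ : Ω => c) := ⟨measurable_const, ‖c‖, fun _ => le_rfl⟩

lemma mul (hg : BoundedMeasurable g) (hh : BoundedMeasurable h) :
    BoundedMeasurable (fun x => g x * h x) := by
  obtain ⟨M, hM⟩ := hg.bounded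
  obtain ⟨M', hM'⟩ := hh.bounded
  refine ⟨hg.measurable.mul hh.measurable, M * M', fun x => ?_⟩
  rw [norm_mul]
  exact mul_le_mul (hM x) (hM' x) (norm_nonneg _) ((norm_nonneg _).trans (hM x))

lemma add (hg : BoundedMeasurable g) (hh : BoundedMeasurable h) :
    BoundedMeasurable (fun x => g x + h x) := by
  obtain ⟨M, hM⟩ := hg.bounded
  obtain ⟨M', hM'⟩ := hh.bounded
  exact ⟨hg.measurable.add hh.measurable, M + M',
    fun x => (norm_add_le _ _).trans (add_le_add (hM x) (hM' x))⟩

lemma sub (hg : BoundedMeasurable g) (hh : BoundedMeasurable h) :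
    BoundedMeasurable (fun x => g x - h x) := by
  obtain ⟨M, hM⟩ := hg.bounded
  obtain ⟨M', hM'⟩ := hh.bounded
  exact ⟨hg.measurable.sub hh.measurable, M + M',
    fun x => (norm_sub_le _ _).trans (add_le_add (hM x) (hM' x))⟩

lemma pow (hg : BoundedMeasurable g) (n : ℕ) : BoundedMeasurable (fun x => g x ^ n) := by
  induction n with
  | zero => simpa using const 1
  | succ n ih => simpa only [pow_succ] using ih.mul hg

lemma finset_sum {ι : Type*} (s : Finset ι) {g : ι → Ω → ℂ} (hg : ∀ i ∈ s, BoundedMeasurable (g i)) :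
    BoundedMeasurable (fun x => ∑ i ∈ s, g i x) := by
  classical
  induction s using Finset.induction_on with
  | empty => simpa using const 0
  | insert a s ha ih =>
    simp only [Finset.sum_insert ha]
    exact (hg a (Finset.mem_insert_self a s)).add
      (ih fun i hi => hg i (Finset.mem_insert_of_mem hi))

lemma indicator {A : Set Ω} (hA : MeasurableSet A) :
    BoundedMeasurable (A.indicator (fun _ => (1 : ℂ))) := by
  refine ⟨measurable_const.indicator hA, 1, fun x => ?_⟩
  by_cases h : x ∈ A <;> simp [h]

lemma comp_tag (g : Ω → ℂ) (p : TaggedPartition Ω) : BoundedMeasurable (fun x => g (p.tag x)) := by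
  refine ⟨(p.tag.map g).measurable, ∑ ξ ∈ p.tags, ‖g ξ‖, fun x => ?_⟩
  exact Finset.single_le_sum (f := fun ξ => ‖g ξ‖) (fun _ _ => norm_nonneg _) (p.tag_mem_tags x)

/-- A bounded measurable function has arbitrarily small oscillation on the cells of a suitable
partition. -/
lemma exists_dist_le (hg : BoundedMeasurable g) {ε : ℝ} (hε : 0 < ε) :
    ∃ p : TaggedPartition Ω, ∀ x y, p.tag x = p.tag y → ‖g x - g y‖ ≤ ε := by
  obtain ⟨M, hM⟩ := hg.bounded
  have hε2 : 0 < ε / 2 := half_pos hε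
  -- The cells are the preimages of the squares of a grid of mesh `ε / 2`.
  let s : MeasureTheory.SimpleFunc Ω (ℤ × ℤ) :=
    { toFun := fun x => (⌊(g x).re / (ε / 2)⌋, ⌊(g x).im / (ε / 2)⌋)
      measurableSet_fiber' := fun b => by
        have h : Measurable fun x => (⌊(g x).re / (ε / 2)⌋, ⌊(g x).im / (ε / 2)⌋) :=
          ((Complex.measurable_re.comp hg.measurable).div_const _).floor.prodMk
            ((Complex.measurable_im.comp hg.measurable).div_const _).floor
        exact h (measurableSet_singleton b)
      finite_range' := by
        refine ((Set.finite_Icc ⌊-M / (ε / 2)⌋ ⌊M / (ε / 2)⌋).prod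
          (Set.finite_Icc ⌊-M / (ε / 2)⌋ ⌊M / (ε / 2)⌋)).subset ?_
        rintro _ ⟨x, rfl⟩
        have h₁ := abs_le.1 ((Complex.abs_re_le_norm (g x)).trans (hM x))
        have h₂ := abs_le.1 ((Complex.abs_im_le_norm (g x)).trans (hM x))
        refine ⟨⟨?_, ?_⟩, ⟨?_, ?_⟩⟩ <;> refine Int.floor_le_floor ?_ <;>
          refine div_le_div_of_nonneg_right ?_ hε2.le
        exacts [h₁.1, h₁.2, h₂.1, h₂.2] }
  obtain ⟨p, hp⟩ := TaggedPartition.exists_tag_eq_imp s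
  refine ⟨p, fun x y h => ?_⟩
  have hs := Prod.ext_iff.1 (hp x y h)
  have key : ∀ a b : ℝ, ⌊a / (ε / 2)⌋ = ⌊b / (ε / 2)⌋ → |a - b| ≤ ε / 2 := by
    intro a b hab
    have := (Int.abs_sub_lt_one_of_floor_eq_floor hab).le
    rwa [← sub_div, abs_div, abs_of_pos hε2, div_le_one hε2] at this
  have h₁ := key _ _ hs.1
  have h₂ := key _ _ hs.2
  refine (Complex.norm_le_abs_re_add_abs_im _).trans ?_
  rw [Complex.sub_re, Complex.sub_im]
  linarith

/-- Along refinement, a bounded measurable function is uniformly approximated by its values at the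
tags. -/
lemma eventually_dist_tag_le (hg : BoundedMeasurable g) {ε : ℝ} (hε : 0 < ε) :
    ∀ᶠ p : TaggedPartition Ω in atTop, ∀ x, ‖g x - g (p.tag x)‖ ≤ ε := by
  obtain ⟨p₀, h₀⟩ := hg.exists_dist_le hε
  filter_upwards [eventually_ge_atTop p₀] with p hp x
  exact h₀ _ _ (TaggedPartition.tag_tag_of_le hp x).symm

end BoundedMeasurable

/-- Partitions that are fine enough respect a given measurable set. -/
lemma eventually_tag_mem_iff {Ω : Type*} [MeasurableSpace Ω] {A : Set Ω} (hA : MeasurableSet A) :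
    ∀ᶠ p : TaggedPartition Ω in atTop, ∀ x, p.tag x ∈ A ↔ x ∈ A := by
  filter_upwards [(BoundedMeasurable.indicator hA).eventually_dist_tag_le one_half_pos] with p hp x
  have := hp x
  by_cases h : x ∈ A <;> by_cases h' : p.tag x ∈ A <;> simp [h, h'] at this ⊢ <;> norm_num at this

/-! ### Boundedness and scalar integrals of spectral measures -/

lemma sum_abs_le_of_forall_subset_sum_le {ι : Type*} (s : Finset ι) (a : ι → ℝ) {K : ℝ}
    (h : ∀ t ⊆ s, |∑ i ∈ t, a i| ≤ K) : ∑ i ∈ s, |a i| ≤ 2 * K := by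
  classical
  rw [← Finset.sum_filter_add_sum_filter_not s (fun i => 0 ≤ a i)]
  have h₁ : ∑ i ∈ s.filter (fun i => 0 ≤ a i), |a i| ≤ K := by
    rw [Finset.sum_congr rfl fun i hi => abs_of_nonneg (Finset.mem_filter.1 hi).2]
    exact (le_abs_self _).trans (h _ (Finset.filter_subset _ _))
  have h₂ : ∑ i ∈ s.filter (fun i => ¬ 0 ≤ a i), |a i| ≤ K := by
    rw [Finset.sum_congr rfl fun i hi => abs_of_neg (not_le.1 (Finset.mem_filter.1 hi).2),
      Finset.sum_neg_distrib]
    exact (neg_le_abs _).trans (h _ (Finset.filter_subset _ _))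
  linarith

/-- A scalar family all of whose subsums are bounded by `K` has total variation at most `4 * K`. -/
lemma norm_sum_mul_le_of_forall_subset_sum_le {ι : Type*} (s : Finset ι) (c z : ι → ℂ) {K M : ℝ}
    (hM0 : 0 ≤ M) (hM : ∀ i ∈ s, ‖c i‖ ≤ M) (h : ∀ t ⊆ s, ‖∑ i ∈ t, z i‖ ≤ K) :
    ‖∑ i ∈ s, c i * z i‖ ≤ 4 * K * M := by
  have hre : ∑ i ∈ s, |(z i).re| ≤ 2 * K := by
    refine sum_abs_le_of_forall_subset_sum_le s _ fun t ht => ?_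
    rw [← Complex.re_sum]
    exact (Complex.abs_re_le_norm _).trans (h t ht)
  have him : ∑ i ∈ s, |(z i).im| ≤ 2 * K := by
    refine sum_abs_le_of_forall_subset_sum_le s _ fun t ht => ?_
    rw [← Complex.im_sum]
    exact (Complex.abs_im_le_norm _).trans (h t ht)
  calc ‖∑ i ∈ s, c i * z i‖ ≤ ∑ i ∈ s, M * (|(z i).re| + |(z i).im|) := by
        refine norm_sum_le_of_le s fun i hi => ?_
        rw [norm_mul]
        exact mul_le_mul (hM i hi) (Complex.norm_le_abs_re_add_abs_im _) (norm_nonneg _) hM0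
    _ = M * (∑ i ∈ s, |(z i).re| + ∑ i ∈ s, |(z i).im|) := by
        rw [← Finset.mul_sum, Finset.sum_add_distrib]
    _ ≤ M * (2 * K + 2 * K) := by gcongr
    _ = 4 * K * M := by ring

namespace SpectralMeasure

variable {Ω : Type*} [MeasurableSpace Ω] {H : Type*} [NormedAddCommGroup H] [NormedSpace ℂ H]

lemma proj_empty (E : SpectralMeasure Ω H) : E.proj ∅ = 0 := by
  ext x
  -- The constant series with term `E(∅) x` converges, so its term vanishes.
  have h := E.proj_iUnion (fun _ => ∅) (fun _ => .empty) (fun i j _ => by simp) x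
  exact tendsto_nhds_unique tendsto_const_nhds h.summable.tendsto_atTop_zero

open Classical in
/-- The vector measure `A ↦ E(A) x`. -/
noncomputable def vectorMeasure (E : SpectralMeasure Ω H) (x : H) :
    MeasureTheory.VectorMeasure Ω H where
  measureOf' A := if MeasurableSet A then E.proj A x else 0
  empty' := by simp [proj_empty]
  not_measurable' A hA := if_neg hA
  m_iUnion' A hA hd := by
    simp only [hA, MeasurableSet.iUnion hA, if_true]
    exact E.proj_iUnion A hA hd x

lemma vectorMeasure_apply (E : SpectralMeasure Ω H) (x : H) {A : Set Ω} (hA : MeasurableSet A) :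
    E.vectorMeasure x A = E.proj A x := if_pos hA

lemma proj_union (E : SpectralMeasure Ω H) {A B : Set Ω} (hA : MeasurableSet A)
    (hB : MeasurableSet B) (h : Disjoint A B) : E.proj (A ∪ B) = E.proj A + E.proj B := by
  ext x
  have := MeasureTheory.VectorMeasure.of_union (v := E.vectorMeasure x) h hA hB
  rwa [vectorMeasure_apply _ _ hA, vectorMeasure_apply _ _ hB,
    vectorMeasure_apply _ _ (hA.union hB)] at this

lemma sum_proj_fiber (E : SpectralMeasure Ω H) {β : Type*} (τ : MeasureTheory.SimpleFunc Ω β)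
    (s : Finset β) : ∑ b ∈ s, E.proj (τ ⁻¹' {b}) = E.proj (τ ⁻¹' (s : Set β)) := by
  classical
  induction s using Finset.induction_on with
  | empty => simp [proj_empty]
  | insert b s hb ih =>
    rw [Finset.sum_insert hb, ih, Finset.coe_insert, Set.insert_eq, Set.preimage_union,
      proj_union _ (τ.measurableSet_preimage _) (τ.measurableSet_preimage _)]
    refine Disjoint.preimage _ ?_
    simpa using hb

/-- A spectral measure is uniformly bounded: each vector measure `A ↦ E(A) x` is bounded, so the
Banach-Steinhaus theorem applies. -/
lemma exists_norm_proj_le [CompleteSpace H] (E : SpectralMeasure Ω H) :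
    ∃ K, ∀ A, MeasurableSet A → ‖E.proj A‖ ≤ K := by
  obtain ⟨K, hK⟩ := banach_steinhaus (g := fun A : {A : Set Ω // MeasurableSet A} => E.proj A)
    fun x => ⟨(E.vectorMeasure x).bound, fun A => by
      rw [← vectorMeasure_apply E x A.2]
      exact MeasureTheory.VectorMeasure.norm_apply_le_bound⟩
  exact ⟨K, fun A hA => hK ⟨A, hA⟩⟩

/-- A constant `C` with `‖∫ g dE‖ ≤ C * sup ‖g‖`. -/
noncomputable def normBound [CompleteSpace H] (E : SpectralMeasure Ω H) : ℝ :=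
  4 * E.exists_norm_proj_le.choose

/-- `∑ h(b) E({τ = b})` for a simple function `τ`. -/
noncomputable def fiberSum (E : SpectralMeasure Ω H) {β : Type*}
    (τ : MeasureTheory.SimpleFunc Ω β) (h : β → ℂ) : H →L[ℂ] H :=
  ∑ b ∈ τ.range, h b • E.proj (τ ⁻¹' {b})

lemma normBound_nonneg [CompleteSpace H] (E : SpectralMeasure Ω H) : 0 ≤ E.normBound :=
  mul_nonneg (by norm_num)
    ((norm_nonneg _).trans (E.exists_norm_proj_le.choose_spec _ MeasurableSet.univ))

/-- Tested against a functional, the values of `E` on unions of fibres are the subsums of a scalar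
family, which bounds its total variation. -/
lemma norm_fiberSum_le [CompleteSpace H] (E : SpectralMeasure Ω H) {β : Type*}
    (τ : MeasureTheory.SimpleFunc Ω β) (h : β → ℂ) {M : ℝ} (hM0 : 0 ≤ M)
    (hM : ∀ b ∈ τ.range, ‖h b‖ ≤ M) : ‖E.fiberSum τ h‖ ≤ E.normBound * M := by
  refine ContinuousLinearMap.opNorm_le_bound _ (mul_nonneg E.normBound_nonneg hM0) fun x => ?_
  refine NormedSpace.norm_le_dual_bound ℂ _
    (mul_nonneg (mul_nonneg E.normBound_nonneg hM0) (norm_nonneg x)) fun φ => ?_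
  set K := E.exists_norm_proj_le.choose with hK
  have hK' := E.exists_norm_proj_le.choose_spec
  have e : φ (E.fiberSum τ h x) = ∑ b ∈ τ.range, h b * φ (E.proj (τ ⁻¹' {b}) x) := by
    simp [fiberSum]
  rw [e]
  have hsub : ∀ t ⊆ τ.range, ‖∑ b ∈ t, φ (E.proj (τ ⁻¹' {b}) x)‖ ≤ ‖φ‖ * (K * ‖x‖) := by
    intro t _
    rw [← map_sum, ← _root_.sum_apply, sum_proj_fiber]
    refine φ.le_opNorm_of_le (ContinuousLinearMap.le_of_opNorm_le _ (hK' _ ?_) x)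
    exact τ.measurableSet_preimage _
  refine (norm_sum_mul_le_of_forall_subset_sum_le _ _ _ hM0 hM hsub).trans (le_of_eq ?_)
  rw [normBound]
  ring

lemma fiberSum_map (E : SpectralMeasure Ω H) {β γ : Type*}
    (τ : MeasureTheory.SimpleFunc Ω β) (k : β → γ) (h : γ → ℂ) :
    E.fiberSum (τ.map k) h = E.fiberSum τ (h ∘ k) := by
  classical
  rw [fiberSum, fiberSum, ← Finset.sum_fiberwise_of_maps_to (t := (τ.map k).range) (g := k)
    (fun b hb => by
      obtain ⟨x, rfl⟩ := MeasureTheory.SimpleFunc.mem_range.1 hb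
      exact MeasureTheory.SimpleFunc.mem_range.2 ⟨x, rfl⟩)]
  refine Finset.sum_congr rfl fun c _ => ?_
  rw [Finset.sum_congr rfl fun b hb => by
    rw [Function.comp_apply, (Finset.mem_filter.1 hb).2], ← Finset.smul_sum, sum_proj_fiber]
  congr 2
  ext x
  simp

/-- The scalar Riemann sum `∑ g(ξ) E(A_ξ)`. -/
noncomputable def scalarSum (E : SpectralMeasure Ω H) (g : Ω → ℂ) (p : TaggedPartition Ω) :
    H →L[ℂ] H :=
  ∑ ξ ∈ p.tags, g ξ • E.proj (p.cell ξ)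

/-- A Riemann sum is also a Riemann sum for every refinement, of the integrand that is constant on
the coarse cells. -/
lemma scalarSum_of_le (E : SpectralMeasure Ω H) (g : Ω → ℂ) {p p' : TaggedPartition Ω}
    (h : p ≤ p') : E.scalarSum g p = E.scalarSum (fun x => g (p.tag x)) p' := by
  have : p.tag = p'.tag.map p.tag := by
    ext x
    exact (TaggedPartition.tag_tag_of_le h x).symm
  have e := E.fiberSum_map p'.tag p.tag g
  rw [← this] at e
  exact e

lemma norm_scalarSum_le [CompleteSpace H] (E : SpectralMeasure Ω H) (g : Ω → ℂ)
    (p : TaggedPartition Ω) {M : ℝ} (hM0 : 0 ≤ M) (hM : ∀ x, ‖g x‖ ≤ M) :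
    ‖E.scalarSum g p‖ ≤ E.normBound * M :=
  E.norm_fiberSum_le p.tag g hM0 fun b _ => hM b

lemma scalarSum_sub (E : SpectralMeasure Ω H) (g h : Ω → ℂ) (p : TaggedPartition Ω) :
    E.scalarSum (fun x => g x - h x) p = E.scalarSum g p - E.scalarSum h p := by
  simp [scalarSum, sub_smul]

lemma scalarSum_add (E : SpectralMeasure Ω H) (g h : Ω → ℂ) (p : TaggedPartition Ω) :
    E.scalarSum (fun x => g x + h x) p = E.scalarSum g p + E.scalarSum h p := by
  simp [scalarSum, add_smul, Finset.sum_add_distrib]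

lemma proj_cell_mul_proj_cell (E : SpectralMeasure Ω H) (p : TaggedPartition Ω) {ξ η : Ω}
    (h : ξ ≠ η) : E.proj (p.cell ξ) * E.proj (p.cell η) = 0 := by
  rw [← E.proj_inter _ _ (p.measurableSet_cell _) (p.measurableSet_cell _)]
  have : p.cell ξ ∩ p.cell η = ∅ := by
    ext x
    simp only [TaggedPartition.cell, Set.mem_inter_iff, Set.mem_preimage, Set.mem_singleton_iff,
      Set.mem_empty_iff_false, iff_false]
    rintro ⟨rfl, h'⟩
    exact h h'
  rw [this, proj_empty]

lemma proj_mul_self (E : SpectralMeasure Ω H) {A : Set Ω} (hA : MeasurableSet A) :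
    E.proj A * E.proj A = E.proj A := by
  rw [← E.proj_inter _ _ hA hA, Set.inter_self]

lemma scalarSum_mul (E : SpectralMeasure Ω H) (g h : Ω → ℂ) (p : TaggedPartition Ω) :
    E.scalarSum (fun x => g x * h x) p = E.scalarSum g p * E.scalarSum h p := by
  rw [scalarSum, scalarSum, scalarSum, Finset.sum_mul_sum]
  refine Finset.sum_congr rfl fun ξ hξ => ?_
  rw [Finset.sum_eq_single_of_mem ξ hξ]
  · rw [smul_mul_smul_comm, proj_mul_self _ (p.measurableSet_cell ξ)]
  · intro η _ hη
    rw [smul_mul_smul_comm, proj_cell_mul_proj_cell _ _ hη.symm, smul_zero]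

lemma scalarSum_const (E : SpectralMeasure Ω H) (c : ℂ) (p : TaggedPartition Ω) :
    E.scalarSum (fun _ => c) p = c • 1 := by
  rw [scalarSum, ← Finset.smul_sum]
  congr 1
  have := E.sum_proj_fiber p.tag p.tags
  refine this.trans ?_
  rw [← E.proj_univ]
  congr 1
  ext x
  simp [p.tag_mem_tags x]

lemma sum_proj_cell (E : SpectralMeasure Ω H) (p : TaggedPartition Ω) :
    ∑ ξ ∈ p.tags, E.proj (p.cell ξ) = 1 := by
  simpa [scalarSum] using E.scalarSum_const 1 p

lemma commute_scalarSum {E : SpectralMeasure Ω H} {T : H →L[ℂ] H}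
    (hT : ∀ A, MeasurableSet A → Commute T (E.proj A)) (g : Ω → ℂ) (p : TaggedPartition Ω) :
    Commute T (E.scalarSum g p) :=
  Commute.sum_right _ _ _ fun ξ _ => (hT _ (p.measurableSet_cell ξ)).smul_right _

/-- `∫ g dE` for scalar `g`, the limit of the scalar Riemann sums. -/
noncomputable def scalarIntegral (E : SpectralMeasure Ω H) (g : Ω → ℂ) : H →L[ℂ] H :=
  limUnder atTop (E.scalarSum g)

section Complete

variable [CompleteSpace H]

lemma tendsto_scalarSum (E : SpectralMeasure Ω H) {g : Ω → ℂ} (hg : BoundedMeasurable g) :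
    Tendsto (E.scalarSum g) atTop (𝓝 (E.scalarIntegral g)) := by
  refine tendsto_nhds_limUnder ?_
  rw [← cauchy_map_iff_exists_tendsto, Metric.cauchy_iff]
  refine ⟨inferInstance, fun ε hε => ?_⟩
  have hC : 0 < 2 * E.normBound + 1 := by linarith [E.normBound_nonneg]
  set δ := ε / (2 * E.normBound + 1) with hδ
  have hδ0 : 0 < δ := div_pos hε hC
  obtain ⟨p₀, h₀⟩ := hg.exists_dist_le hδ0
  have key : ∀ p, p₀ ≤ p → ‖E.scalarSum g p - E.scalarSum g p₀‖ ≤ E.normBound * δ := by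
    intro p hp
    rw [E.scalarSum_of_le g hp, ← scalarSum_sub]
    exact E.norm_scalarSum_le _ _ hδ0.le fun x => h₀ _ _ (p₀.tag_tag x).symm
  refine ⟨_, image_mem_map (Ici_mem_atTop p₀), ?_⟩
  rintro _ ⟨p, hp, rfl⟩ _ ⟨p', hp', rfl⟩
  calc dist (E.scalarSum g p) (E.scalarSum g p')
      ≤ dist (E.scalarSum g p) (E.scalarSum g p₀) + dist (E.scalarSum g p') (E.scalarSum g p₀) :=
        dist_triangle_right _ _ _
    _ ≤ E.normBound * δ + E.normBound * δ := by
        rw [dist_eq_norm, dist_eq_norm]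
        exact add_le_add (key p hp) (key p' hp')
    _ < (2 * E.normBound + 1) * δ := by linarith
    _ = ε := mul_div_cancel₀ _ hC.ne'

lemma scalarIntegral_mul (E : SpectralMeasure Ω H) {g h : Ω → ℂ} (hg : BoundedMeasurable g)
    (hh : BoundedMeasurable h) :
    E.scalarIntegral (fun x => g x * h x) = E.scalarIntegral g * E.scalarIntegral h :=
  tendsto_nhds_unique (E.tendsto_scalarSum (hg.mul hh))
    (((E.tendsto_scalarSum hg).mul (E.tendsto_scalarSum hh)).congr fun p =>
      (E.scalarSum_mul g h p).symm)

lemma scalarIntegral_add (E : SpectralMeasure Ω H) {g h : Ω → ℂ} (hg : BoundedMeasurable g)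
    (hh : BoundedMeasurable h) :
    E.scalarIntegral (fun x => g x + h x) = E.scalarIntegral g + E.scalarIntegral h :=
  tendsto_nhds_unique (E.tendsto_scalarSum (hg.add hh))
    (((E.tendsto_scalarSum hg).add (E.tendsto_scalarSum hh)).congr fun p =>
      (E.scalarSum_add g h p).symm)

lemma scalarIntegral_sub (E : SpectralMeasure Ω H) {g h : Ω → ℂ} (hg : BoundedMeasurable g)
    (hh : BoundedMeasurable h) :
    E.scalarIntegral (fun x => g x - h x) = E.scalarIntegral g - E.scalarIntegral h :=
  tendsto_nhds_unique (E.tendsto_scalarSum (hg.sub hh))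
    (((E.tendsto_scalarSum hg).sub (E.tendsto_scalarSum hh)).congr fun p =>
      (E.scalarSum_sub g h p).symm)

lemma scalarIntegral_const (E : SpectralMeasure Ω H) (c : ℂ) :
    E.scalarIntegral (fun _ => c) = c • 1 :=
  tendsto_nhds_unique (E.tendsto_scalarSum (BoundedMeasurable.const c))
    (tendsto_const_nhds.congr fun p => (E.scalarSum_const c p).symm)

lemma scalarIntegral_const_mul (E : SpectralMeasure Ω H) {g : Ω → ℂ} (hg : BoundedMeasurable g)
    (c : ℂ) : E.scalarIntegral (fun x => c * g x) = c • E.scalarIntegral g := by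
  rw [E.scalarIntegral_mul (.const c) hg, scalarIntegral_const, smul_one_mul]

lemma scalarIntegral_pow (E : SpectralMeasure Ω H) {g : Ω → ℂ} (hg : BoundedMeasurable g)
    (n : ℕ) : E.scalarIntegral (fun x => g x ^ n) = E.scalarIntegral g ^ n := by
  induction n with
  | zero => simpa using E.scalarIntegral_const 1
  | succ n ih =>
    simp only [pow_succ]
    rw [E.scalarIntegral_mul (hg.pow n) hg, ih]

lemma scalarIntegral_finset_sum (E : SpectralMeasure Ω H) {ι : Type*} (s : Finset ι)
    {g : ι → Ω → ℂ} (hg : ∀ i ∈ s, BoundedMeasurable (g i)) :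
    E.scalarIntegral (fun x => ∑ i ∈ s, g i x) = ∑ i ∈ s, E.scalarIntegral (g i) := by
  classical
  induction s using Finset.induction_on with
  | empty => simpa using E.scalarIntegral_const 0
  | insert a s ha ih =>
    have hs : ∀ i ∈ s, BoundedMeasurable (g i) := fun i hi => hg i (Finset.mem_insert_of_mem hi)
    simp only [Finset.sum_insert ha]
    rw [E.scalarIntegral_add (hg a (Finset.mem_insert_self a s)) (.finset_sum s hs), ih hs]

/-- The integral of a function that is constant on the cells of `p` is the Riemann sum. -/
lemma scalarIntegral_comp_tag (E : SpectralMeasure Ω H) (g : Ω → ℂ) (p : TaggedPartition Ω) :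
    E.scalarIntegral (fun x => g (p.tag x)) = E.scalarSum g p := by
  refine tendsto_nhds_unique (E.tendsto_scalarSum (.comp_tag g p)) (tendsto_const_nhds.congr' ?_)
  filter_upwards [eventually_ge_atTop p] with p' hp
  exact E.scalarSum_of_le g hp

lemma scalarIntegral_indicator (E : SpectralMeasure Ω H) {A : Set Ω} (hA : MeasurableSet A) :
    E.scalarIntegral (A.indicator fun _ => (1 : ℂ)) = E.proj A := by
  classical
  refine tendsto_nhds_unique (E.tendsto_scalarSum (.indicator hA)) (tendsto_const_nhds.congr' ?_)
  filter_upwards [eventually_tag_mem_iff hA] with p hp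
  have e : E.scalarSum (A.indicator fun _ => (1 : ℂ)) p
      = ∑ ξ ∈ p.tags.filter (· ∈ A), E.proj (p.cell ξ) := by
    rw [scalarSum, Finset.sum_filter]
    refine Finset.sum_congr rfl fun ξ _ => ?_
    by_cases h : ξ ∈ A <;> simp [h]
  rw [e]
  refine Eq.trans ?_ (E.sum_proj_fiber p.tag _).symm
  congr 1
  ext x
  simp [p.tag_mem_tags x, hp x]

lemma norm_scalarIntegral_le (E : SpectralMeasure Ω H) {g : Ω → ℂ} (hg : BoundedMeasurable g)
    {M : ℝ} (hM0 : 0 ≤ M) (hM : ∀ x, ‖g x‖ ≤ M) : ‖E.scalarIntegral g‖ ≤ E.normBound * M :=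
  le_of_tendsto (E.tendsto_scalarSum hg).norm
    (Eventually.of_forall fun p => E.norm_scalarSum_le g p hM0 hM)

lemma commute_scalarIntegral {E : SpectralMeasure Ω H} {T : H →L[ℂ] H}
    (hT : ∀ A, MeasurableSet A → Commute T (E.proj A)) {g : Ω → ℂ} (hg : BoundedMeasurable g) :
    Commute T (E.scalarIntegral g) :=
  tendsto_nhds_unique ((E.tendsto_scalarSum hg).const_mul T)
    (((E.tendsto_scalarSum hg).mul_const T).congr fun p => (commute_scalarSum hT g p).eq.symm)

end Complete

end SpectralMeasure

/-! ### Parts of an operator with a spectral decomposition -/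

/-- A consequence of Gelfand's formula: the powers of `a` grow at most geometrically, with any ratio
exceeding the spectral radius. -/
lemma exists_norm_pow_le_of_spectralRadius_lt {A : Type*} [NormedRing A] [NormedAlgebra ℂ A]
    [CompleteSpace A] (a : A) {ρ : ℝ} (hρ0 : 0 < ρ) (h : spectralRadius ℂ a < ENNReal.ofReal ρ) :
    ∃ C, 0 ≤ C ∧ ∀ q : ℕ, ‖a ^ q‖ ≤ C * ρ ^ q := by
  have hev : ∀ᶠ n : ℕ in atTop, ‖a ^ n‖ ≤ 1 * ‖ρ ^ n‖ := by
    filter_upwards [(spectrum.pow_norm_pow_one_div_tendsto_nhds_spectralRadius a).eventually_lt_const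
      h, eventually_gt_atTop 0] with n hn hn0
    have hn' := (ENNReal.ofReal_lt_ofReal_iff hρ0).1 hn
    rw [one_mul, Real.norm_of_nonneg (pow_nonneg hρ0.le n)]
    calc ‖a ^ n‖ = (‖a ^ n‖ ^ (1 / n : ℝ)) ^ n := by
          rw [one_div, Real.rpow_inv_natCast_pow (norm_nonneg _) hn0.ne']
      _ ≤ ρ ^ n := pow_le_pow_left₀ (Real.rpow_nonneg (norm_nonneg _) _) hn'.le n
  obtain ⟨C, hC0, hC⟩ := Asymptotics.bound_of_isBigO_nat_atTop
    (Asymptotics.IsBigO.of_bound 1 hev)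
  refine ⟨C, hC0.le, fun q => ?_⟩
  have := hC (x := q) (pow_pos hρ0 q).ne'
  rwa [Real.norm_of_nonneg (pow_nonneg hρ0.le q)] at this

section Restriction

variable {H : Type*} [NormedAddCommGroup H] [NormedSpace ℂ H]

lemma coe_restrictRange_sub_pow_apply {X P : H →L[ℂ] H} (h : Commute X P) (ξ : ℂ) (q : ℕ)
    (v : LinearMap.range P.toLinearMap) :
    (((restrictRange X P h - algebraMap ℂ _ ξ) ^ q) v : H) = ((X - ξ • 1) ^ q) (v : H) := by
  induction q with
  | zero => simp
  | succ q ih =>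
    rw [pow_succ', pow_succ', mul_apply_eq_comp, mul_apply_eq_comp, ← ih]
    simp [restrictRange, Algebra.algebraMap_eq_smul_one]

lemma exists_norm_sub_pow_apply_le [CompleteSpace H] (T : H →L[ℂ] H) {ξ : ℂ} {δ ρ : ℝ}
    (hδ : 0 ≤ δ) (hρ : δ < ρ) (hs : spectrum ℂ T ⊆ Metric.closedBall ξ δ) :
    ∃ C, 0 ≤ C ∧ ∀ (q : ℕ) (x : H), ‖((T - algebraMap ℂ _ ξ) ^ q) x‖ ≤ C * ρ ^ q * ‖x‖ := by
  have hρ0 : 0 < ρ := hδ.trans_lt hρ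
  have hrad : spectralRadius ℂ (T - algebraMap ℂ _ ξ) ≤ ENNReal.ofReal δ := by
    refine iSup₂_le fun k hk => ?_
    have hk' : ξ + k ∈ spectrum ℂ T := by
      rwa [add_comm, spectrum.add_mem_iff, neg_add_eq_sub]
    have := hs hk'
    rw [Metric.mem_closedBall, dist_eq_norm, add_sub_cancel_left] at this
    rw [← enorm_eq_nnnorm, ← ofReal_norm]
    exact ENNReal.ofReal_le_ofReal this
  obtain ⟨C, hC0, hC⟩ := exists_norm_pow_le_of_spectralRadius_lt (T - algebraMap ℂ _ ξ) hρ0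
    (hrad.trans_lt ((ENNReal.ofReal_lt_ofReal_iff hρ0).2 hρ))
  exact ⟨C, hC0, fun q x => ContinuousLinearMap.le_of_opNorm_le _ (hC q) x⟩

/-- If the restriction of `X` to the range of a commuting projection `P` has spectrum in the disc
of radius `δ` about `ξ`, then the powers of `(X - ξ) P` grow at most like those of any `ρ > δ`, by
Gelfand's formula on the range of `P`. -/
lemma exists_norm_sub_pow_mul_le [CompleteSpace H] {X P : H →L[ℂ] H} (h : Commute X P)
    (hP : P * P = P) {ξ : ℂ} {δ ρ : ℝ} (hδ : 0 ≤ δ) (hρ : δ < ρ)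
    (hs : spectrum ℂ (restrictRange X P h) ⊆ Metric.closedBall ξ δ) :
    ∃ C, ∀ q : ℕ, ‖(X - ξ • 1) ^ q * P‖ ≤ C * ρ ^ q := by
  have hclosed : IsClosed (LinearMap.range P.toLinearMap : Set H) := by
    have : (LinearMap.range P.toLinearMap : Set H) = {x | P x = x} := by
      ext x
      constructor
      · rintro ⟨y, rfl⟩
        exact DFunLike.congr_fun hP y
      · exact fun hx => ⟨x, hx⟩
    rw [this]
    exact isClosed_eq P.continuous continuous_id
  have : CompleteSpace (LinearMap.range P.toLinearMap) := hclosed.completeSpace_coe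
  have hρ0 : 0 < ρ := hδ.trans_lt hρ
  obtain ⟨C, hC0, hC⟩ := exists_norm_sub_pow_apply_le (restrictRange X P h) hδ hρ hs
  refine ⟨C * ‖P‖, fun q => ContinuousLinearMap.opNorm_le_bound _ (by positivity) fun x => ?_⟩
  have e := coe_restrictRange_sub_pow_apply h ξ q ⟨P x, LinearMap.mem_range_self P.toLinearMap x⟩
  rw [mul_apply_eq_comp, ← e, mul_assoc C, mul_comm ‖P‖, ← mul_assoc, mul_assoc (C * ρ ^ q)]
  refine (hC q _).trans ?_
  exact mul_le_mul_of_nonneg_left (P.le_opNorm x) (mul_nonneg hC0 (pow_nonneg hρ0.le q))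

end Restriction

namespace SpectralMeasure

variable {Ω : Type*} [MeasurableSpace Ω] {H : Type*} [NormedAddCommGroup H] [NormedSpace ℂ H]

lemma riemannSum_smul_one (E : SpectralMeasure Ω H) (g : Ω → ℂ) :
    E.riemannSum (fun z => g z • (1 : H →L[ℂ] H)) = E.scalarSum g := by
  ext1 p
  simp [riemannSum, scalarSum]

lemma commute_proj (E : SpectralMeasure Ω H) {A B : Set Ω} (hA : MeasurableSet A)
    (hB : MeasurableSet B) : Commute (E.proj A) (E.proj B) := by
  rw [commute_iff_eq, ← E.proj_inter _ _ hA hB, ← E.proj_inter _ _ hB hA, Set.inter_comm]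

end SpectralMeasure

namespace SpectralDecomposition

variable {H : Type*} [NormedAddCommGroup H] [NormedSpace ℂ H] [CompleteSpace H] {X : H →L[ℂ] H}

lemma boundedMeasurable_coe (X : H →L[ℂ] H) :
    BoundedMeasurable (fun z : spectrum ℂ X => (z : ℂ)) := by
  refine ⟨measurable_subtype_coe, ?_⟩
  obtain ⟨M, hM⟩ := (spectrum.isBounded (𝕜 := ℂ) X).exists_norm_le
  exact ⟨M, fun x => hM x x.2⟩

omit [CompleteSpace H] in
lemma projPart_eq (D : SpectralDecomposition X) :
    D.projPart = D.E.scalarIntegral (fun z => (z : ℂ)) := by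
  rw [projPart, SpectralMeasure.integral, SpectralMeasure.riemannSum_smul_one]
  rfl

lemma tendsto_riemannSum_projPart (D : SpectralDecomposition X) :
    Tendsto (D.E.riemannSum fun z => (z : ℂ) • (1 : H →L[ℂ] H)) atTop (𝓝 D.projPart) := by
  rw [SpectralMeasure.riemannSum_smul_one, projPart_eq]
  exact D.E.tendsto_scalarSum (boundedMeasurable_coe X)

lemma tendsto_riemannSum_nilPart (D : SpectralDecomposition X) :
    Tendsto (D.E.riemannSum fun z => X - (z : ℂ) • (1 : H →L[ℂ] H)) atTop (𝓝 (X - D.projPart)) := by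
  refine (D.tendsto_riemannSum_projPart.const_sub X).congr fun p => ?_
  simp only [SpectralMeasure.riemannSum, sub_mul, Finset.sum_sub_distrib, ← Finset.mul_sum,
    SpectralMeasure.sum_proj_cell, mul_one]

lemma nilPart_eq (D : SpectralDecomposition X) : D.nilPart = X - D.projPart :=
  D.tendsto_riemannSum_nilPart.limUnder_eq

lemma projPart_add_nilPart (D : SpectralDecomposition X) : D.projPart + D.nilPart = X := by
  rw [nilPart_eq, add_sub_cancel]

lemma commute_projPart_proj (D : SpectralDecomposition X) {A : Set (spectrum ℂ X)}
    (hA : MeasurableSet A) : Commute D.projPart (D.E.proj A) := by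
  rw [projPart_eq]
  exact (SpectralMeasure.commute_scalarIntegral (fun B hB => D.E.commute_proj hA hB)
    (boundedMeasurable_coe X)).symm

lemma commute_nilPart_proj (D : SpectralDecomposition X) {A : Set (spectrum ℂ X)}
    (hA : MeasurableSet A) : Commute D.nilPart (D.E.proj A) := by
  rw [nilPart_eq]
  exact (D.commute A hA).sub_left (D.commute_projPart_proj hA)

lemma commute_nilPart_scalarIntegral (D : SpectralDecomposition X) {g : spectrum ℂ X → ℂ}
    (hg : BoundedMeasurable g) : Commute D.nilPart (D.E.scalarIntegral g) :=
  SpectralMeasure.commute_scalarIntegral (fun _ hA => D.commute_nilPart_proj hA) hg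

lemma commute_nilPart_projPart (D : SpectralDecomposition X) : Commute D.nilPart D.projPart := by
  rw [projPart_eq]
  exact D.commute_nilPart_scalarIntegral (boundedMeasurable_coe X)

lemma commute_self_projPart (D : SpectralDecomposition X) : Commute X D.projPart := by
  rw [projPart_eq]
  exact SpectralMeasure.commute_scalarIntegral D.commute (boundedMeasurable_coe X)

lemma boundedMeasurable_sub_pow (X : H →L[ℂ] H) (ξ : ℂ) (k : ℕ) :
    BoundedMeasurable (fun z : spectrum ℂ X => ((z : ℂ) - ξ) ^ k) :=
  ((boundedMeasurable_coe X).sub (.const ξ)).pow k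

lemma projPart_sub_pow_mul_proj (D : SpectralDecomposition X) (ξ : ℂ) (k : ℕ)
    {A : Set (spectrum ℂ X)} (hA : MeasurableSet A) :
    (D.projPart - ξ • 1) ^ k * D.E.proj A
      = D.E.scalarIntegral fun z => ((z : ℂ) - ξ) ^ k * A.indicator (fun _ => (1 : ℂ)) z := by
  have hz := boundedMeasurable_coe X
  rw [D.E.scalarIntegral_mul (boundedMeasurable_sub_pow X ξ k) (.indicator hA),
    D.E.scalarIntegral_indicator hA, D.E.scalarIntegral_pow (hz.sub (.const ξ)),
    D.E.scalarIntegral_sub hz (.const ξ), D.E.scalarIntegral_const, projPart_eq]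

/-- The nilpotent part is quasinilpotent. Only the spectral condition on the restrictions of `X`
to the ranges of the projections is used: on a cell of diameter at most `δ` with tag `ξ`, both
`X - ξ` and `X_P - ξ` have powers of order `δ ^ q`, and the nilpotent part is their difference. -/
lemma exists_norm_nilPart_pow_le (D : SpectralDecomposition X) {ε : ℝ} (hε : 0 < ε) :
    ∃ C, 0 ≤ C ∧ ∀ q : ℕ, ‖D.nilPart ^ q‖ ≤ C * ε ^ q := by
  have hδ : 0 < ε / 3 := by positivity
  set δ := ε / 3 with hδdef
  -- With mesh `ε / 3`, the powers of `X - ξ` are `O((2 * δ)^q)` and those of `X_P - ξ` are `O(δ^q)`.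
  obtain ⟨p, hp⟩ := (boundedMeasurable_coe X).exists_dist_le hδ
  have hcell : ∀ ξ ∈ p.tags, ∀ z ∈ p.cell ξ, ‖(z : ℂ) - ξ‖ ≤ δ := by
    intro ξ hξ z hz
    exact hp z ξ (Eq.trans hz (TaggedPartition.mem_tags.1 hξ).symm)
  have key : ∀ ξ ∈ p.tags, ∃ C, 0 ≤ C ∧ ∀ q : ℕ,
      ‖D.nilPart ^ q * D.E.proj (p.cell ξ)‖ ≤ C * ε ^ q := by
    intro ξ hξ
    have hA := p.measurableSet_cell ξ
    set P := D.E.proj (p.cell ξ) with hPdef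
    have hsp : spectrum ℂ (restrictRange X P (D.commute _ hA)) ⊆ Metric.closedBall (ξ : ℂ) δ := by
      refine (D.spectrum_restrict _ hA).trans (closure_minimal ?_ Metric.isClosed_closedBall)
      rintro _ ⟨z, hz, rfl⟩
      rw [Metric.mem_closedBall, dist_eq_norm]
      exact hcell ξ hξ z hz
    obtain ⟨C, hC⟩ := exists_norm_sub_pow_mul_le (D.commute _ hA) (D.E.proj_mul_self hA)
      (ρ := 2 * δ) hδ.le (by linarith) hsp
    have hC0 : 0 ≤ C := by simpa using (norm_nonneg _).trans (hC 0)
    have hS : ∀ k : ℕ, ‖(-(D.projPart - (ξ : ℂ) • 1)) ^ k * P‖ ≤ D.E.normBound * δ ^ k := by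
      intro k
      rw [neg_pow, mul_assoc, projPart_sub_pow_mul_proj D _ _ hA]
      have h1 : ‖D.E.scalarIntegral fun z => ((z : ℂ) - ξ) ^ k *
          (p.cell ξ).indicator (fun _ => (1 : ℂ)) z‖ ≤ D.E.normBound * δ ^ k := by
        refine D.E.norm_scalarIntegral_le
          ((boundedMeasurable_sub_pow X ξ k).mul (.indicator hA)) (by positivity) fun z => ?_
        by_cases hz : z ∈ p.cell ξ
        · simpa [hz] using pow_le_pow_left₀ (norm_nonneg _) (hcell ξ hξ z hz) k
        · simpa [hz] using pow_nonneg hδ.le k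
      rcases neg_one_pow_eq_or (H →L[ℂ] H) k with h | h <;> simpa [h] using h1
    refine ⟨C * D.E.normBound, mul_nonneg hC0 D.E.normBound_nonneg, fun q => ?_⟩
    have hcomm : Commute (X - (ξ : ℂ) • 1) (-(D.projPart - (ξ : ℂ) • 1)) := by
      refine Commute.neg_right (Commute.sub_left (Commute.sub_right D.commute_self_projPart ?_)
        ((Commute.one_left _).smul_left _))
      exact (Commute.one_right _).smul_right _
    have hN : D.nilPart = (X - (ξ : ℂ) • 1) + -(D.projPart - (ξ : ℂ) • 1) := by
      rw [nilPart_eq]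
      abel
    have hPS : ∀ k : ℕ, Commute ((-(D.projPart - (ξ : ℂ) • 1)) ^ k) P := fun k =>
      (((D.commute_projPart_proj hA).sub_left
        ((Commute.one_left _).smul_left _)).neg_left).pow_left k
    have expand : D.nilPart ^ q * P = ∑ m ∈ Finset.range (q + 1), (q.choose m : ℂ) •
        (((X - (ξ : ℂ) • 1) ^ m * P) * ((-(D.projPart - (ξ : ℂ) • 1)) ^ (q - m) * P)) := by
      rw [hN, hcomm.add_pow, Finset.sum_mul]
      refine Finset.sum_congr rfl fun m _ => ?_
      set Z := (-(D.projPart - (ξ : ℂ) • 1)) ^ (q - m) with hZ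
      have hZP : Z * P = P * Z := (hPS (q - m)).eq
      have hPP : P * P = P := D.E.proj_mul_self hA
      have h1 : (X - (ξ : ℂ) • 1) ^ m * P * (Z * P) = (X - (ξ : ℂ) • 1) ^ m * (Z * P) := by
        rw [hZP, mul_assoc, ← mul_assoc P, hPP]
      rw [h1, Nat.cast_smul_eq_nsmul, nsmul_eq_mul, ← (Nat.cast_commute _ _).eq, ← mul_assoc,
        ← mul_assoc, ← mul_assoc]
    rw [expand]
    calc _ ≤ ∑ m ∈ Finset.range (q + 1), (q.choose m : ℝ) *
          ((C * (2 * δ) ^ m) * (D.E.normBound * δ ^ (q - m))) := by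
          refine norm_sum_le_of_le _ fun m _ => ?_
          rw [norm_smul, Complex.norm_natCast]
          gcongr
          exact (norm_mul_le _ _).trans (mul_le_mul (hC m) (hS _) (norm_nonneg _) (by positivity))
      _ = C * D.E.normBound * (2 * δ + δ) ^ q := by
          rw [add_pow, Finset.mul_sum]
          exact Finset.sum_congr rfl fun m _ => by ring
      _ = C * D.E.normBound * ε ^ q := by
          rw [hδdef]
          ring_nf
  choose! C hC0 hC using key
  refine ⟨∑ ξ ∈ p.tags, C ξ, Finset.sum_nonneg hC0, fun q => ?_⟩
  rw [← mul_one (D.nilPart ^ q), ← D.E.sum_proj_cell p, Finset.mul_sum, Finset.sum_mul]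
  exact norm_sum_le_of_le _ fun ξ hξ => hC ξ hξ q

end SpectralDecomposition

/-! ### Convergence of single Riemann sums -/

/-- An array of coefficients `d q ξ` that grows in `q` at most like `M / t ^ q`, uniformly in `ξ`:
the Taylor coefficients at `ξ` of a function that is bounded by `M` on the discs of radius `t`. -/
structure TaylorBound {Ω : Type*} [MeasurableSpace Ω] (t M : ℝ) (d : ℕ → Ω → ℂ) : Prop where
  nonneg : 0 ≤ M
  measurable : ∀ q, Measurable (d q)
  norm_le : ∀ q ξ, ‖d q ξ‖ ≤ M / t ^ q

lemma TaylorBound.boundedMeasurable {Ω : Type*} [MeasurableSpace Ω] {t M : ℝ} {d : ℕ → Ω → ℂ}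
    (h : TaylorBound t M d) (q : ℕ) : BoundedMeasurable (d q) :=
  ⟨h.measurable q, _, h.norm_le q⟩

lemma tendsto_zero_of_eventually_norm_le {ι F : Type*} [SeminormedAddCommGroup F] {l : Filter ι}
    {f : ι → F} (K : ℝ) (h : ∀ ε, 0 < ε → ε ≤ 1 → ∀ᶠ i in l, ‖f i‖ ≤ K * ε) :
    Tendsto f l (𝓝 0) := by
  rw [Metric.tendsto_nhds]
  intro ε hε
  have hK : 0 < |K| + 1 := by positivity
  filter_upwards [h (min 1 (ε / (|K| + 1) / 2)) (by positivity) (min_le_left _ _)] with i hi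
  rw [dist_zero_right]
  calc ‖f i‖ ≤ K * min 1 (ε / (|K| + 1) / 2) := hi
    _ ≤ (|K| + 1) * (ε / (|K| + 1) / 2) :=
        mul_le_mul ((le_abs_self K).trans (by linarith)) (min_le_right _ _) (by positivity) hK.le
    _ = ε / 2 := by field_simp
    _ < ε := half_lt_self hε

/-- The indicator, as a complex number, of the exponents that belong to a part when no order
function cuts them off: `q = 0` for `P` and `q ≥ 1` for `N`. -/
noncomputable def SpectralPart.indicator : SpectralPart → ℕ → ℂ
  | SpectralPart.P, q => if q = 0 then 1 else 0
  | SpectralPart.N, q => if q = 0 then 0 else 1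

lemma SpectralPart.indicator_add (q : ℕ) :
    SpectralPart.P.indicator q + SpectralPart.N.indicator q = 1 := by
  by_cases h : q = 0 <;> simp [indicator, h]

lemma SpectralPart.norm_indicator_le (a : SpectralPart) (q : ℕ) : ‖a.indicator q‖ ≤ 1 := by
  cases a <;> by_cases h : q = 0 <;> simp [indicator, h]

namespace SpectralDecomposition

variable {H : Type*} [NormedAddCommGroup H] [NormedSpace ℂ H] {X : H →L[ℂ] H}

/-- The single Riemann sum `∑_ξ ∑_q d(q, ξ) (X - ξ)^q E(A_ξ)` over the exponents of a part. -/
noncomputable def partSum (D : SpectralDecomposition X) (a : SpectralPart)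
    (d : ℕ → spectrum ℂ X → ℂ) (p : TaggedPartition (spectrum ℂ X)) : H →L[ℂ] H :=
  ∑ ξ ∈ p.tags, ∑ q ∈ D.exponents a ξ, d q ξ • D.weight p ξ q

/-- The limit `∑_q X_N^q ∫ d(q, λ) dE(λ)` of the single Riemann sums, over `q = 0` for the
projection part and over all `q ≥ 1` for the nilpotent part: the order function leaves no trace. -/
noncomputable def partLimit (D : SpectralDecomposition X) (a : SpectralPart)
    (d : ℕ → spectrum ℂ X → ℂ) : H →L[ℂ] H :=
  ∑' q, a.indicator q • (D.nilPart ^ q * D.E.scalarIntegral (d q))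

/-- The indicator of the exponents of a part at `z`, as a complex number. -/
noncomputable def cutoff (D : SpectralDecomposition X) (a : SpectralPart) (q : ℕ)
    (z : spectrum ℂ X) : ℂ := if q ∈ D.exponents a z then 1 else 0

lemma norm_cutoff_le (D : SpectralDecomposition X) (a : SpectralPart) (q : ℕ)
    (z : spectrum ℂ X) : ‖D.cutoff a q z‖ ≤ 1 := by
  by_cases h : q ∈ D.exponents a z <;> simp [cutoff, h]

lemma cutoff_P (D : SpectralDecomposition X) (q : ℕ) :
    D.cutoff SpectralPart.P q = fun _ => SpectralPart.P.indicator q := by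
  ext z
  simp [cutoff, exponents, SpectralPart.indicator]

lemma cutoff_N (D : SpectralDecomposition X) (q : ℕ) :
    D.cutoff SpectralPart.N q = fun z => SpectralPart.N.indicator q *
      {z | q < D.order z}.indicator (fun _ => (1 : ℂ)) z := by
  ext z
  rcases Nat.eq_zero_or_pos q with h | h
  · simp [cutoff, exponents, SpectralPart.indicator, h]
  · by_cases h' : q < D.order z <;>
      simp [cutoff, exponents, SpectralPart.indicator, h', h.ne', Nat.one_le_iff_ne_zero]

lemma measurableSet_lt_order (D : SpectralDecomposition X) (q : ℕ) :
    MeasurableSet {z | q < D.order z} := D.measurable_order measurableSet_Ioi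

lemma boundedMeasurable_cutoff (D : SpectralDecomposition X) (a : SpectralPart) (q : ℕ) :
    BoundedMeasurable (D.cutoff a q) := by
  cases a
  · rw [cutoff_P]
    exact .const _
  · rw [cutoff_N]
    exact (BoundedMeasurable.const _).mul (.indicator (D.measurableSet_lt_order q))

variable [CompleteSpace H]

omit [CompleteSpace H] in
lemma nilPart_pow_mul_proj_lt_order (D : SpectralDecomposition X) (q : ℕ) :
    D.nilPart ^ q * D.E.proj {z | q < D.order z} = D.nilPart ^ q := by
  have hm : MeasurableSet {z | D.order z ≤ q} := D.measurable_order measurableSet_Iic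
  have hu : {z | D.order z ≤ q} ∪ {z | q < D.order z} = Set.univ := by
    ext z
    simp [le_or_gt]
  have hd : Disjoint {z | D.order z ≤ q} {z | q < D.order z} := by
    rw [Set.disjoint_left]
    intro z h h'
    simp only [Set.mem_ofPred_eq] at h h'
    omega
  have h0 : D.nilPart ^ q * D.E.proj {z | D.order z ≤ q} = 0 := D.pow_order q
  have h1 := D.E.proj_union hm (D.measurableSet_lt_order q) hd
  rw [hu, D.E.proj_univ] at h1
  calc D.nilPart ^ q * D.E.proj {z | q < D.order z}
      = D.nilPart ^ q * (D.E.proj {z | D.order z ≤ q} + D.E.proj {z | q < D.order z}) := by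
        rw [mul_add, h0, zero_add]
    _ = D.nilPart ^ q := by rw [← h1, mul_one]

/-- After multiplication by `X_N^q` the cutoff at the order function is invisible, because
`X_N^q` vanishes on `{λ | m_λ ≤ q}`. -/
lemma nilPart_pow_mul_scalarIntegral_cutoff (D : SpectralDecomposition X) (a : SpectralPart)
    (q : ℕ) {g : spectrum ℂ X → ℂ} (hg : BoundedMeasurable g) :
    D.nilPart ^ q * D.E.scalarIntegral (fun z => D.cutoff a q z * g z)
      = a.indicator q • (D.nilPart ^ q * D.E.scalarIntegral g) := by
  have hi := BoundedMeasurable.indicator (D.measurableSet_lt_order q)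
  cases a
  · simp only [cutoff_P]
    rw [D.E.scalarIntegral_const_mul hg, mul_smul_comm]
  · simp only [cutoff_N, mul_assoc]
    rw [D.E.scalarIntegral_const_mul (hi.mul hg), D.E.scalarIntegral_mul hi hg,
      D.E.scalarIntegral_indicator (D.measurableSet_lt_order q), mul_smul_comm, ← mul_assoc,
      nilPart_pow_mul_proj_lt_order]

/-- The binomial expansion of `(X - ξ)^q = (X_N + (X_P - ξ))^q` in a Riemann sum. -/
lemma sum_smul_weight (D : SpectralDecomposition X) (c : spectrum ℂ X → ℂ) (q : ℕ)
    (p : TaggedPartition (spectrum ℂ X)) :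
    ∑ ξ ∈ p.tags, c ξ • D.weight p ξ q
      = ∑ k ∈ Finset.range (q + 1), (q.choose k : ℂ) • (D.nilPart ^ k *
          D.E.scalarIntegral fun z : spectrum ℂ X => c (p.tag z) * ((z : ℂ) - p.tag z) ^ (q - k)) := by
  have hint : ∀ j : ℕ, ∑ ξ ∈ p.tags, c ξ • ((D.projPart - (ξ : ℂ) • 1) ^ j * D.E.proj (p.cell ξ))
      = D.E.scalarIntegral fun z : spectrum ℂ X => c (p.tag z) * ((z : ℂ) - p.tag z) ^ j := by
    intro j
    have hb : ∀ ξ ∈ p.tags, BoundedMeasurable fun z : spectrum ℂ X =>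
        ((z : ℂ) - ξ) ^ j * (p.cell ξ).indicator (fun _ => (1 : ℂ)) z := fun ξ _ =>
      (boundedMeasurable_sub_pow X ξ j).mul (.indicator (p.measurableSet_cell ξ))
    have e : (fun z : spectrum ℂ X => c (p.tag z) * ((z : ℂ) - p.tag z) ^ j)
        = fun z : spectrum ℂ X => ∑ ξ ∈ p.tags, c ξ *
          (((z : ℂ) - ξ) ^ j * (p.cell ξ).indicator (fun _ => (1 : ℂ)) z) := by
      ext z
      rw [Finset.sum_eq_single_of_mem _ (p.tag_mem_tags z)]
      · simp [TaggedPartition.cell]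
      · intro ξ _ hξ
        simp [TaggedPartition.cell, hξ.symm]
    rw [e, D.E.scalarIntegral_finset_sum _ fun ξ hξ => (BoundedMeasurable.const _).mul (hb ξ hξ)]
    refine Finset.sum_congr rfl fun ξ hξ => ?_
    rw [D.E.scalarIntegral_const_mul (hb ξ hξ),
      D.projPart_sub_pow_mul_proj _ _ (p.measurableSet_cell ξ)]
  have hw : ∀ ξ ∈ p.tags, c ξ • D.weight p ξ q = ∑ k ∈ Finset.range (q + 1),
      (q.choose k : ℂ) • (D.nilPart ^ k *
        (c ξ • ((D.projPart - (ξ : ℂ) • 1) ^ (q - k) * D.E.proj (p.cell ξ)))) := by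
    intro ξ _
    have hcomm : Commute D.nilPart (D.projPart - (ξ : ℂ) • 1) :=
      D.commute_nilPart_projPart.sub_right ((Commute.one_right _).smul_right _)
    have hX : X - (ξ : ℂ) • 1 = D.nilPart + (D.projPart - (ξ : ℂ) • 1) := by
      rw [nilPart_eq]
      abel
    rw [weight, hX, hcomm.add_pow, Finset.sum_mul, Finset.smul_sum]
    refine Finset.sum_congr rfl fun k _ => ?_
    rw [mul_smul_comm, smul_comm, Nat.cast_smul_eq_nsmul, nsmul_eq_mul, ← (Nat.cast_commute _ _).eq,
      mul_assoc, mul_assoc]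
  rw [Finset.sum_congr rfl hw, Finset.sum_comm]
  refine Finset.sum_congr rfl fun k _ => ?_
  rw [← Finset.smul_sum, ← Finset.mul_sum, hint]

/-- On cells of size `δ`, the factor `(λ - ξ)^j` in the binomial expansion contributes `δ^j`. -/
lemma norm_scalarIntegral_cutoff_mul_le (D : SpectralDecomposition X) (a : SpectralPart)
    {t M δ : ℝ} (ht : 0 < t) {d : ℕ → spectrum ℂ X → ℂ} (hd : TaylorBound t M d)
    {p : TaggedPartition (spectrum ℂ X)} (hδ : 0 ≤ δ) (hp : ∀ z : spectrum ℂ X, ‖(z : ℂ) - p.tag z‖ ≤ δ)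
    (q j : ℕ) :
    ‖D.E.scalarIntegral fun z : spectrum ℂ X => D.cutoff a q (p.tag z) * d q (p.tag z) *
      ((z : ℂ) - p.tag z) ^ j‖ ≤ D.E.normBound * (M / t ^ q * δ ^ j) := by
  have hM := hd.nonneg
  refine D.E.norm_scalarIntegral_le ?_ (by positivity) fun z => ?_
  · refine (BoundedMeasurable.comp_tag (fun z => D.cutoff a q z * d q z) p).mul
      (((boundedMeasurable_coe X).sub ?_).pow j)
    exact BoundedMeasurable.comp_tag (fun z : spectrum ℂ X => (z : ℂ)) p
  · rw [norm_mul, norm_pow]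
    refine mul_le_mul ?_ (pow_le_pow_left₀ (norm_nonneg _) (hp z) j) (by positivity) (by positivity)
    rw [norm_mul, ← one_mul (M / t ^ q)]
    exact mul_le_mul (D.norm_cutoff_le _ _ _) (hd.norm_le _ _) (norm_nonneg _) zero_le_one

omit [CompleteSpace H] in
lemma partSum_eq_tsum (D : SpectralDecomposition X) (a : SpectralPart)
    (d : ℕ → spectrum ℂ X → ℂ) (p : TaggedPartition (spectrum ℂ X)) :
    D.partSum a d p = ∑' q, ∑ ξ ∈ p.tags, (D.cutoff a q ξ * d q ξ) • D.weight p ξ q := by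
  have hB : ∀ ξ ∈ p.tags, D.exponents a ξ ⊆ p.tags.biUnion (D.exponents a) :=
    fun ξ hξ => Finset.subset_biUnion_of_mem _ hξ
  rw [tsum_eq_sum (s := p.tags.biUnion (D.exponents a)), Finset.sum_comm]
  · refine Finset.sum_congr rfl fun ξ hξ => ?_
    rw [← Finset.sum_subset (hB ξ hξ)]
    · refine Finset.sum_congr rfl fun q hq => ?_
      simp [cutoff, hq]
    · intro q _ hq
      simp [cutoff, hq]
  · intro q hq
    refine Finset.sum_eq_zero fun ξ hξ => ?_
    have : q ∉ D.exponents a ξ := fun h => hq (hB ξ hξ h)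
    simp [cutoff, this]

/-- On fine partitions, the single Riemann sums are dominated by a geometric series whose size
depends on the coefficients only through their bound. Quasinilpotency of `X_N` makes up for the
possibly small radius `t`. -/
lemma exists_norm_sum_smul_weight_le (D : SpectralDecomposition X) {t : ℝ} (ht : 0 < t) :
    ∃ C, 0 ≤ C ∧ ∀ᶠ p : TaggedPartition (spectrum ℂ X) in atTop,
      ∀ (a : SpectralPart) (M : ℝ) (d : ℕ → spectrum ℂ X → ℂ), TaylorBound t M d → ∀ q : ℕ,
        ‖∑ ξ ∈ p.tags, (D.cutoff a q ξ * d q ξ) • D.weight p ξ q‖ ≤ C * M * (1 / 2) ^ q := by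
  -- With mesh `t / 4` and `‖X_N^k‖ = O((t / 4)^k)`, the binomial sum is `O((t / 4 + t / 4)^q)`,
  -- which beats `1 / t^q` by a factor `2^q`.
  have hδ : 0 < t / 4 := by positivity
  obtain ⟨C, hC0, hC⟩ := D.exists_norm_nilPart_pow_le hδ
  refine ⟨C * D.E.normBound, mul_nonneg hC0 D.E.normBound_nonneg, ?_⟩
  filter_upwards [(boundedMeasurable_coe X).eventually_dist_tag_le hδ] with p hp a M d hd q
  have hM := hd.nonneg
  rw [D.sum_smul_weight (fun z => D.cutoff a q z * d q z)]
  calc _ ≤ ∑ k ∈ Finset.range (q + 1), (q.choose k : ℝ) *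
        ((C * (t / 4) ^ k) * (D.E.normBound * (M / t ^ q * (t / 4) ^ (q - k)))) := by
        refine norm_sum_le_of_le _ fun k _ => ?_
        rw [norm_smul, Complex.norm_natCast]
        gcongr
        exact (norm_mul_le _ _).trans (mul_le_mul (hC k)
          (D.norm_scalarIntegral_cutoff_mul_le a ht hd hδ.le hp q (q - k)) (norm_nonneg _)
          (by positivity))
    _ = C * D.E.normBound * M * ((t / 4 + t / 4) ^ q / t ^ q) := by
        rw [add_pow, Finset.sum_div, Finset.mul_sum]
        exact Finset.sum_congr rfl fun m _ => by ring
    _ = C * D.E.normBound * M * (1 / 2) ^ q := by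
        rw [← div_pow]
        congr 2
        field_simp
        norm_num

lemma exists_norm_partSum_le (D : SpectralDecomposition X) {t : ℝ} (ht : 0 < t) :
    ∃ C, 0 ≤ C ∧ ∀ᶠ p : TaggedPartition (spectrum ℂ X) in atTop,
      ∀ (a : SpectralPart) (M : ℝ) (d : ℕ → spectrum ℂ X → ℂ), TaylorBound t M d →
        ‖D.partSum a d p‖ ≤ C * M := by
  obtain ⟨C, hC0, hC⟩ := D.exists_norm_sum_smul_weight_le ht
  refine ⟨C * 2, by positivity, ?_⟩
  filter_upwards [hC] with p hp a M d hd
  rw [partSum_eq_tsum, mul_assoc, mul_comm 2 M, ← mul_assoc]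
  exact tsum_of_norm_bounded (hasSum_geometric_two.mul_left (C * M)) (hp a M d hd)

lemma tendsto_sum_smul_weight (D : SpectralDecomposition X) (a : SpectralPart) {t M : ℝ}
    (ht : 0 < t) {d : ℕ → spectrum ℂ X → ℂ} (hd : TaylorBound t M d) (q : ℕ) :
    Tendsto (fun p : TaggedPartition (spectrum ℂ X) =>
      ∑ ξ ∈ p.tags, (D.cutoff a q ξ * d q ξ) • D.weight p ξ q) atTop
      (𝓝 (a.indicator q • (D.nilPart ^ q * D.E.scalarIntegral (d q)))) := by
  have hM := hd.nonneg
  have hb := (D.boundedMeasurable_cutoff a q).mul (hd.boundedMeasurable q)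
  -- The term `k = q` of the binomial expansion carries the limit; the others tend to `0`.
  have hmain : Tendsto (fun p : TaggedPartition (spectrum ℂ X) =>
      (q.choose q : ℂ) • (D.nilPart ^ q * D.E.scalarIntegral fun z : spectrum ℂ X =>
        D.cutoff a q (p.tag z) * d q (p.tag z) * ((z : ℂ) - p.tag z) ^ (q - q))) atTop
      (𝓝 (a.indicator q • (D.nilPart ^ q * D.E.scalarIntegral (d q)))) := by
    rw [← D.nilPart_pow_mul_scalarIntegral_cutoff a q (hd.boundedMeasurable q)]
    refine ((D.E.tendsto_scalarSum hb).const_mul (D.nilPart ^ q)).congr fun p => ?_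
    rw [← D.E.scalarIntegral_comp_tag]
    simp
  have hrest : Tendsto (fun p : TaggedPartition (spectrum ℂ X) =>
      ∑ k ∈ Finset.range q, (q.choose k : ℂ) • (D.nilPart ^ k * D.E.scalarIntegral fun z : spectrum ℂ X =>
        D.cutoff a q (p.tag z) * d q (p.tag z) * ((z : ℂ) - p.tag z) ^ (q - k))) atTop (𝓝 0) := by
    rw [← Finset.sum_const_zero (s := Finset.range q)]
    refine tendsto_finsetSum _ fun k hk => ?_
    have hk' : q - k ≠ 0 := Nat.sub_ne_zero_of_lt (Finset.mem_range.1 hk)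
    refine tendsto_zero_of_eventually_norm_le
      (q.choose k * (‖D.nilPart ^ k‖ * (D.E.normBound * (M / t ^ q)))) fun ε hε hε1 => ?_
    filter_upwards [(boundedMeasurable_coe X).eventually_dist_tag_le hε] with p hp
    rw [norm_smul, Complex.norm_natCast, mul_assoc]
    gcongr
    refine (norm_mul_le _ _).trans ?_
    rw [mul_assoc]
    gcongr
    refine (D.norm_scalarIntegral_cutoff_mul_le a ht hd hε.le hp q (q - k)).trans ?_
    rw [mul_assoc]
    have := D.E.normBound_nonneg
    gcongr
    exact pow_le_of_le_one hε.le hε1 hk'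
  have := hrest.add hmain
  rw [zero_add] at this
  refine this.congr fun p => ?_
  rw [D.sum_smul_weight (fun z => D.cutoff a q z * d q z), Finset.sum_range_succ]

lemma tendsto_partSum (D : SpectralDecomposition X) (a : SpectralPart) {t M : ℝ}
    (ht : 0 < t) {d : ℕ → spectrum ℂ X → ℂ} (hd : TaylorBound t M d) :
    Tendsto (D.partSum a d) atTop (𝓝 (D.partLimit a d)) := by
  obtain ⟨C, hC0, hC⟩ := D.exists_norm_sum_smul_weight_le ht
  rw [funext (D.partSum_eq_tsum a d)]
  refine tendsto_tsum_of_dominated_convergence (summable_geometric_two.mul_left (C * M))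
    (fun q => D.tendsto_sum_smul_weight a ht hd q) ?_
  filter_upwards [hC] with p hp
  exact hp a M d hd

lemma exists_norm_partLimit_le (D : SpectralDecomposition X) {t : ℝ} (ht : 0 < t) :
    ∃ C, 0 ≤ C ∧ ∀ (a : SpectralPart) (M : ℝ) (d : ℕ → spectrum ℂ X → ℂ), TaylorBound t M d →
        ‖D.partLimit a d‖ ≤ C * M := by
  obtain ⟨C, hC0, hC⟩ := D.exists_norm_partSum_le ht
  refine ⟨C, hC0, fun a M d hd => le_of_tendsto (D.tendsto_partSum a ht hd).norm ?_⟩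
  filter_upwards [hC] with p hp using hp a M d hd

end SpectralDecomposition

/-! ### Double Riemann sums -/

section DoubleSum

variable {H : Type*} [NormedAddCommGroup H] [NormedSpace ℂ H] {X₁ X₂ : H →L[ℂ] H}

/-- If the coefficients of a double sum are sums of products `d_i(q₁, ξ₁) e_i(q₂, ξ₂)`, then the
double sum is the sum of the products of single Riemann sums. -/
lemma hasSum_partSum_mul_partSum (D₁ : SpectralDecomposition X₁) (D₂ : SpectralDecomposition X₂)
    (a b : SpectralPart) (β : ℂ → ℂ → ℂ) (Y : H →L[ℂ] H) {ι : Type*}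
    {d : ι → ℕ → spectrum ℂ X₁ → ℂ} {e : ι → ℕ → spectrum ℂ X₂ → ℂ}
    (hβ : ∀ ξ₁ ξ₂, ∀ q₁ ∈ D₁.exponents a ξ₁, ∀ q₂ ∈ D₂.exponents b ξ₂,
      HasSum (fun i => d i q₁ ξ₁ * e i q₂ ξ₂)
        (mixedDeriv β q₁ q₂ ξ₁ ξ₂ / ((q₁.factorial : ℂ) * (q₂.factorial : ℂ))))
    (p : TaggedPartition (spectrum ℂ X₁) × TaggedPartition (spectrum ℂ X₂)) :
    HasSum (fun i => D₁.partSum a (d i) p.1 * Y * D₂.partSum b (e i) p.2)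
      (doubleSum D₁ D₂ (D₁.exponents a) (D₂.exponents b) β Y p) := by
  have h : ∀ i, D₁.partSum a (d i) p.1 * Y * D₂.partSum b (e i) p.2
      = ∑ ξ₁ ∈ p.1.tags, ∑ ξ₂ ∈ p.2.tags, ∑ q₁ ∈ D₁.exponents a ξ₁, ∑ q₂ ∈ D₂.exponents b ξ₂,
        (d i q₁ ξ₁ * e i q₂ ξ₂) • (D₁.weight p.1 ξ₁ q₁ * Y * D₂.weight p.2 ξ₂ q₂) := by
    intro i
    rw [SpectralDecomposition.partSum, SpectralDecomposition.partSum, Finset.sum_mul,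
      Finset.sum_mul_sum]
    refine Finset.sum_congr rfl fun ξ₁ _ => Finset.sum_congr rfl fun ξ₂ _ => ?_
    rw [Finset.sum_mul, Finset.sum_mul_sum]
    refine Finset.sum_congr rfl fun q₁ _ => Finset.sum_congr rfl fun q₂ _ => ?_
    rw [smul_mul_assoc, smul_mul_smul_comm]
  simp only [h]
  exact hasSum_sum fun ξ₁ _ => hasSum_sum fun ξ₂ _ => hasSum_sum fun q₁ hq₁ =>
    hasSum_sum fun q₂ hq₂ => (hβ ξ₁ ξ₂ q₁ hq₁ q₂ hq₂).smul_const _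

variable [CompleteSpace H]

lemma summable_partLimit_mul_partLimit (D₁ : SpectralDecomposition X₁)
    (D₂ : SpectralDecomposition X₂) (a b : SpectralPart) (Y : H →L[ℂ] H) {ι : Type*} {t : ℝ}
    (ht : 0 < t) {d : ι → ℕ → spectrum ℂ X₁ → ℂ} {e : ι → ℕ → spectrum ℂ X₂ → ℂ} {M K : ι → ℝ}
    (hd : ∀ i, TaylorBound t (M i) (d i)) (he : ∀ i, TaylorBound t (K i) (e i))
    (hs : Summable fun i => M i * K i) :
    Summable fun i => D₁.partLimit a (d i) * Y * D₂.partLimit b (e i) := by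
  obtain ⟨C₁, hC₁, h₁⟩ := D₁.exists_norm_partLimit_le ht
  obtain ⟨C₂, hC₂, h₂⟩ := D₂.exists_norm_partLimit_le ht
  refine Summable.of_norm_bounded (hs.mul_left (C₁ * ‖Y‖ * C₂)) fun i => ?_
  have := (hd i).nonneg
  calc _ ≤ (C₁ * M i) * ‖Y‖ * (C₂ * K i) := by
        refine (norm_mul_le _ _).trans (mul_le_mul ((norm_mul_le _ _).trans ?_) (h₂ b _ _ (he i))
          (norm_nonneg _) (by positivity))
        exact mul_le_mul_of_nonneg_right (h₁ a _ _ (hd i)) (norm_nonneg _)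
    _ = C₁ * ‖Y‖ * C₂ * (M i * K i) := by ring

/-- Convergence of a double operator integral whose coefficients are absolutely convergent sums of
products of a function of the first and a function of the second variable. -/
lemma tendsto_doubleSum (D₁ : SpectralDecomposition X₁) (D₂ : SpectralDecomposition X₂)
    (a b : SpectralPart) (β : ℂ → ℂ → ℂ) (Y : H →L[ℂ] H) {ι : Type*} {t : ℝ} (ht : 0 < t)
    {d : ι → ℕ → spectrum ℂ X₁ → ℂ} {e : ι → ℕ → spectrum ℂ X₂ → ℂ} {M K : ι → ℝ}
    (hd : ∀ i, TaylorBound t (M i) (d i)) (he : ∀ i, TaylorBound t (K i) (e i))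
    (hs : Summable fun i => M i * K i)
    (hβ : ∀ ξ₁ ξ₂, ∀ q₁ ∈ D₁.exponents a ξ₁, ∀ q₂ ∈ D₂.exponents b ξ₂,
      HasSum (fun i => d i q₁ ξ₁ * e i q₂ ξ₂)
        (mixedDeriv β q₁ q₂ ξ₁ ξ₂ / ((q₁.factorial : ℂ) * (q₂.factorial : ℂ)))) :
    Tendsto (doubleSum D₁ D₂ (D₁.exponents a) (D₂.exponents b) β Y) atTop
      (𝓝 (∑' i, D₁.partLimit a (d i) * Y * D₂.partLimit b (e i))) := by
  have e₀ : doubleSum D₁ D₂ (D₁.exponents a) (D₂.exponents b) β Y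
      = fun p => ∑' i, D₁.partSum a (d i) p.1 * Y * D₂.partSum b (e i) p.2 :=
    funext fun p => (hasSum_partSum_mul_partSum D₁ D₂ a b β Y hβ p).tsum_eq.symm
  obtain ⟨C₁, hC₁, h₁⟩ := D₁.exists_norm_partSum_le ht
  obtain ⟨C₂, hC₂, h₂⟩ := D₂.exists_norm_partSum_le ht
  rw [e₀, ← prod_atTop_atTop_eq]
  refine tendsto_tsum_of_dominated_convergence (hs.mul_left (C₁ * ‖Y‖ * C₂)) (fun i => ?_) ?_
  · exact (((D₁.tendsto_partSum a ht (hd i)).comp tendsto_fst).mul_const Y).mul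
      ((D₂.tendsto_partSum b ht (he i)).comp tendsto_snd)
  · filter_upwards [h₁.prod_mk h₂] with p hp i
    have := (hd i).nonneg
    calc _ ≤ (C₁ * M i) * ‖Y‖ * (C₂ * K i) := by
          refine (norm_mul_le _ _).trans (mul_le_mul ((norm_mul_le _ _).trans ?_)
            (hp.2 b _ _ (he i)) (norm_nonneg _) (by positivity))
          exact mul_le_mul_of_nonneg_right (hp.1 a _ _ (hd i)) (norm_nonneg _)
      _ = C₁ * ‖Y‖ * C₂ * (M i * K i) := by ring

end DoubleSum

section PowerIntegral

variable {Ω : Type*} [MeasurableSpace Ω] {H : Type*} [NormedAddCommGroup H] [NormedSpace ℂ H]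

/-- A quasinilpotent operator that commutes with a spectral measure. -/
structure SpectralMeasure.CommutingQuasinilpotent (E : SpectralMeasure Ω H) (ν : H →L[ℂ] H) :
    Prop where
  commute : ∀ A, MeasurableSet A → Commute ν (E.proj A)
  norm_pow_le : ∀ ε : ℝ, 0 < ε → ∃ C, 0 ≤ C ∧ ∀ q : ℕ, ‖ν ^ q‖ ≤ C * ε ^ q

/-- The functional calculus `∑_q ν^q ∫ d(q, λ) dE(λ)`; with `d(q, λ) = φ^{(q)}(λ) / q!` it is
`φ(S + ν)`, where `S = ∫ λ dE(λ)`. -/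
noncomputable def SpectralMeasure.powerIntegral (E : SpectralMeasure Ω H) (ν : H →L[ℂ] H)
    (d : ℕ → Ω → ℂ) : H →L[ℂ] H :=
  ∑' q, ν ^ q * E.scalarIntegral (d q)

/-- The Cauchy product of two coefficient arrays. -/
def cauchyProduct (d d' : ℕ → Ω → ℂ) : ℕ → Ω → ℂ :=
  fun q ξ => ∑ k ∈ Finset.range (q + 1), d k ξ * d' (q - k) ξ

namespace SpectralMeasure

lemma commutingQuasinilpotent_zero (E : SpectralMeasure Ω H) : E.CommutingQuasinilpotent 0 := by
  refine ⟨fun A _ => Commute.zero_left _, fun ε hε => ⟨‖(1 : H →L[ℂ] H)‖, norm_nonneg _, ?_⟩⟩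
  rintro (_ | q)
  · simp
  · simpa using by positivity

namespace CommutingQuasinilpotent

variable [CompleteSpace H] {E : SpectralMeasure Ω H} {ν : H →L[ℂ] H} {t M : ℝ}
  {d d' : ℕ → Ω → ℂ}

lemma exists_norm_pow_mul_scalarIntegral_le (hν : E.CommutingQuasinilpotent ν) (ht : 0 < t) :
    ∃ C, 0 ≤ C ∧ ∀ (M : ℝ) (d : ℕ → Ω → ℂ), TaylorBound t M d → ∀ q : ℕ,
      ‖ν ^ q * E.scalarIntegral (d q)‖ ≤ C * M * (1 / 2) ^ q := by
  obtain ⟨C, hC0, hC⟩ := hν.norm_pow_le (t / 2) (by positivity)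
  refine ⟨C * E.normBound, mul_nonneg hC0 E.normBound_nonneg, fun M d hd q => ?_⟩
  have hM := hd.nonneg
  calc _ ≤ (C * (t / 2) ^ q) * (E.normBound * (M / t ^ q)) :=
        (norm_mul_le _ _).trans (mul_le_mul (hC q) (E.norm_scalarIntegral_le
          (hd.boundedMeasurable q) (by positivity) (hd.norm_le q)) (norm_nonneg _) (by positivity))
    _ = C * E.normBound * M * (t / 2 / t) ^ q := by
        rw [div_pow (t / 2)]
        ring
    _ = _ := by
        congr 2
        field_simp

lemma exists_norm_powerIntegral_le (hν : E.CommutingQuasinilpotent ν) (ht : 0 < t) :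
    ∃ C, 0 ≤ C ∧ ∀ (M : ℝ) (d : ℕ → Ω → ℂ), TaylorBound t M d →
      ‖E.powerIntegral ν d‖ ≤ C * M := by
  obtain ⟨C, hC0, hC⟩ := hν.exists_norm_pow_mul_scalarIntegral_le ht
  refine ⟨C * 2, by positivity, fun M d hd => ?_⟩
  rw [mul_assoc, mul_comm 2 M, ← mul_assoc]
  exact tsum_of_norm_bounded (hasSum_geometric_two.mul_left (C * M)) (hC M d hd)

lemma summable_norm (hν : E.CommutingQuasinilpotent ν) (ht : 0 < t) (hd : TaylorBound t M d) :
    Summable fun q => ‖ν ^ q * E.scalarIntegral (d q)‖ := by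
  obtain ⟨C, hC0, hC⟩ := hν.exists_norm_pow_mul_scalarIntegral_le ht
  exact Summable.of_nonneg_of_le (fun _ => norm_nonneg _) (hC M d hd)
    (summable_geometric_two.mul_left (C * M))

/-- The calculus is multiplicative: `ν` commutes with the scalar integrals, so this is the product
formula for absolutely convergent series. -/
lemma powerIntegral_cauchyProduct (hν : E.CommutingQuasinilpotent ν) {t' M' : ℝ} (ht : 0 < t)
    (hd : TaylorBound t M d) (ht' : 0 < t') (hd' : TaylorBound t' M' d') :
    E.powerIntegral ν (cauchyProduct d d') = E.powerIntegral ν d * E.powerIntegral ν d' := by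
  rw [powerIntegral, powerIntegral, powerIntegral,
    tsum_mul_tsum_eq_tsum_sum_range_of_summable_norm (hν.summable_norm ht hd)
      (hν.summable_norm ht' hd')]
  refine tsum_congr fun q => ?_
  have hb : ∀ k ∈ Finset.range (q + 1), BoundedMeasurable fun ξ => d k ξ * d' (q - k) ξ :=
    fun k _ => (hd.boundedMeasurable k).mul (hd'.boundedMeasurable _)
  have e : E.scalarIntegral (cauchyProduct d d' q)
      = ∑ k ∈ Finset.range (q + 1), E.scalarIntegral fun ξ => d k ξ * d' (q - k) ξ :=
    E.scalarIntegral_finset_sum _ hb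
  rw [e, Finset.mul_sum]
  refine Finset.sum_congr rfl fun k hk => ?_
  have hkq : k + (q - k) = q := by
    have := Finset.mem_range.1 hk
    omega
  have hcomm : Commute (ν ^ (q - k)) (E.scalarIntegral (d k)) :=
    (commute_scalarIntegral hν.commute (hd.boundedMeasurable k)).pow_left _
  rw [E.scalarIntegral_mul (hd.boundedMeasurable k) (hd'.boundedMeasurable _),
    mul_assoc (ν ^ k), ← mul_assoc _ (ν ^ (q - k)), ← hcomm.eq, mul_assoc, ← mul_assoc (ν ^ k),
    ← pow_add, hkq]

lemma powerIntegral_indicator_mul (hν : E.CommutingQuasinilpotent ν) (ht : 0 < t)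
    (hd : TaylorBound t M d) {A : Set Ω} (hA : MeasurableSet A) :
    E.powerIntegral ν (fun q ξ => A.indicator (fun _ => (1 : ℂ)) ξ * d q ξ)
      = E.powerIntegral ν d * E.proj A := by
  rw [powerIntegral, powerIntegral, ← (hν.summable_norm ht hd).of_norm.tsum_mul_right]
  refine tsum_congr fun q => ?_
  rw [E.scalarIntegral_mul (.indicator hA) (hd.boundedMeasurable q),
    E.scalarIntegral_indicator hA, mul_assoc]
  congr 1
  exact commute_scalarIntegral (fun B hB => E.commute_proj hA hB) (hd.boundedMeasurable q)

end CommutingQuasinilpotent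

/-- Only the term `q = 0` survives, as `0 ^ 0 = 1`. -/
lemma powerIntegral_zero (E : SpectralMeasure Ω H) (d : ℕ → Ω → ℂ) :
    E.powerIntegral 0 d = E.scalarIntegral (d 0) := by
  rw [powerIntegral, tsum_eq_single 0]
  · simp
  · intro q hq
    simp [hq]

end SpectralMeasure

namespace SpectralDecomposition

variable [CompleteSpace H] {X : H →L[ℂ] H}

lemma commutingQuasinilpotent_nilPart (D : SpectralDecomposition X) :
    D.E.CommutingQuasinilpotent D.nilPart :=
  ⟨fun _ hA => D.commute_nilPart_proj hA, fun _ hε => D.exists_norm_nilPart_pow_le hε⟩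

omit [CompleteSpace H] in
lemma partLimit_P (D : SpectralDecomposition X) (d : ℕ → spectrum ℂ X → ℂ) :
    D.partLimit SpectralPart.P d = D.E.powerIntegral 0 d := by
  rw [SpectralMeasure.powerIntegral_zero, partLimit, tsum_eq_single 0]
  · simp [SpectralPart.indicator]
  · intro q hq
    simp [SpectralPart.indicator, hq]

lemma partLimit_P_add_partLimit_N (D : SpectralDecomposition X) {t M : ℝ} (ht : 0 < t)
    {d : ℕ → spectrum ℂ X → ℂ} (hd : TaylorBound t M d) :
    D.partLimit SpectralPart.P d + D.partLimit SpectralPart.N d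
      = D.E.powerIntegral D.nilPart d := by
  have hs := D.commutingQuasinilpotent_nilPart.summable_norm ht hd
  have h : ∀ a : SpectralPart, Summable fun q =>
      a.indicator q • (D.nilPart ^ q * D.E.scalarIntegral (d q)) := by
    refine fun a => Summable.of_norm_bounded hs fun q => ?_
    rw [norm_smul]
    exact mul_le_of_le_one_left (norm_nonneg _) (a.norm_indicator_le q)
  rw [partLimit, partLimit, ← (h _).tsum_add (h _)]
  refine tsum_congr fun q => ?_
  rw [← add_smul, SpectralPart.indicator_add, one_smul]

end SpectralDecomposition

end PowerIntegral

/-! ### Taylor coefficients of holomorphic functions -/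

lemma DifferentiableOn.iteratedDeriv_of_isOpen {V : Set ℂ} (hV : IsOpen V) {φ : ℂ → ℂ}
    (h : DifferentiableOn ℂ φ V) (q : ℕ) : DifferentiableOn ℂ (iteratedDeriv q φ) V := by
  induction q with
  | zero => simpa using h
  | succ q ih =>
    rw [iteratedDeriv_succ]
    exact ih.deriv hV

/-- A normally convergent series of holomorphic functions may be differentiated termwise any
number of times. -/
lemma hasSum_iteratedDeriv {ι : Type*} {V : Set ℂ} (hV : IsOpen V) {F : ι → ℂ → ℂ} {G : ℂ → ℂ}
    {u : ι → ℝ} (hu : Summable u) (hF : ∀ i, DifferentiableOn ℂ (F i) V)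
    (hle : ∀ i, ∀ z ∈ V, ‖F i z‖ ≤ u i) (hG : ∀ z ∈ V, HasSum (fun i => F i z) (G z)) (q : ℕ)
    {z : ℂ} (hz : z ∈ V) :
    HasSum (fun i => iteratedDeriv q (F i) z) (iteratedDeriv q G z) := by
  have hsum : ∀ s : Finset ι, DifferentiableOn ℂ (fun z => ∑ i ∈ s, F i z) V :=
    fun s => DifferentiableOn.fun_sum fun i _ => hF i
  have key : TendstoLocallyUniformlyOn
      (fun (s : Finset ι) => iteratedDeriv q fun z => ∑ i ∈ s, F i z) (iteratedDeriv q G) atTop V := by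
    induction q with
    | zero =>
      simp only [iteratedDeriv_zero]
      refine ((tendstoUniformlyOn_tsum hu fun i z hz => hle i z hz).congr_right
        fun z hz => (hG z hz).tsum_eq).tendstoLocallyUniformlyOn
    | succ q ih =>
      simp only [iteratedDeriv_succ]
      exact ih.deriv (Eventually.of_forall fun s => (hsum s).iteratedDeriv_of_isOpen hV q) hV
  refine (key.tendsto_at hz).congr fun s => ?_
  exact iteratedDeriv_fun_sum fun i _ => ((hF i).contDiffOn hV).contDiffAt (hV.mem_nhds hz)

/-- Termwise mixed differentiation of a normally convergent series of products `φ_i(w₁) ψ_i(w₂)`. -/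
lemma hasSum_mixedDeriv {ι : Type*} {V₁ V₂ : Set ℂ} (hV₁ : IsOpen V₁) (hV₂ : IsOpen V₂)
    {φ ψ : ι → ℂ → ℂ} {M K : ι → ℝ} {β : ℂ → ℂ → ℂ} (hs : Summable fun i => M i * K i)
    (hφ : ∀ i, DifferentiableOn ℂ (φ i) V₁) (hψ : ∀ i, DifferentiableOn ℂ (ψ i) V₂)
    (hM : ∀ i, ∀ z ∈ V₁, ‖φ i z‖ ≤ M i) (hK : ∀ i, ∀ z ∈ V₂, ‖ψ i z‖ ≤ K i)
    (hβ : ∀ w₁ ∈ V₁, ∀ w₂ ∈ V₂, HasSum (fun i => φ i w₁ * ψ i w₂) (β w₁ w₂))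
    (q₁ q₂ : ℕ) {z₁ z₂ : ℂ} (hz₁ : z₁ ∈ V₁) (hz₂ : z₂ ∈ V₂) :
    HasSum (fun i => iteratedDeriv q₁ (φ i) z₁ * iteratedDeriv q₂ (ψ i) z₂)
      (mixedDeriv β q₁ q₂ z₁ z₂) := by
  have hM0 : ∀ i, 0 ≤ M i := fun i => (norm_nonneg _).trans (hM i z₁ hz₁)
  have h₂ : ∀ w₁ ∈ V₁, HasSum (fun i => φ i w₁ * iteratedDeriv q₂ (ψ i) z₂)
      (iteratedDeriv q₂ (fun w₂ => β w₁ w₂) z₂) := by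
    intro w₁ hw₁
    have := hasSum_iteratedDeriv hV₂ (F := fun i w₂ => φ i w₁ * ψ i w₂) hs
      (fun i => (hψ i).const_mul _) (fun i z hz => by
        rw [norm_mul]
        exact mul_le_mul (hM i w₁ hw₁) (hK i z hz) (norm_nonneg _) (hM0 i))
      (fun w₂ hw₂ => hβ w₁ hw₁ w₂ hw₂) q₂ hz₂
    simpa only [iteratedDeriv_const_mul_field] using this
  obtain ⟨ρ, hρ, hball⟩ := Metric.nhds_basis_closedBall.mem_iff.1 (hV₂.mem_nhds hz₂)
  have hc : ∀ i, ‖iteratedDeriv q₂ (ψ i) z₂‖ ≤ q₂.factorial * K i / ρ ^ q₂ := fun i =>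
    Complex.norm_iteratedDeriv_le_of_forall_mem_sphere_norm_le q₂ hρ
      (((hψ i).mono hball).diffContOnCl_ball subset_rfl)
      fun z hz => hK i z (hball (Metric.sphere_subset_closedBall hz))
  have hs' : Summable fun i => M i * (q₂.factorial * K i / ρ ^ q₂) := by
    refine (hs.mul_left (q₂.factorial / ρ ^ q₂)).congr fun i => by ring
  have := hasSum_iteratedDeriv hV₁ (F := fun i w₁ => φ i w₁ * iteratedDeriv q₂ (ψ i) z₂) hs'
    (fun i => (hφ i).mul_const _) (fun i z hz => by
      rw [norm_mul]
      exact mul_le_mul (hM i z hz) (hc i) (norm_nonneg _) (hM0 i)) h₂ q₁ hz₁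
  simp only [iteratedDeriv_mul_const_field] at this
  exact this

/-- The Taylor coefficients `φ^{(q)}(ξ) / q!` at the points of `K`. -/
noncomputable def taylorCoeff (K : Set ℂ) (φ : ℂ → ℂ) : ℕ → K → ℂ :=
  fun q ξ => iteratedDeriv q φ ξ / q.factorial

lemma taylorCoeff_mul {K V : Set ℂ} (hV : IsOpen V) (hKV : K ⊆ V) {φ ψ : ℂ → ℂ}
    (hφ : DifferentiableOn ℂ φ V) (hψ : DifferentiableOn ℂ ψ V) :
    taylorCoeff K (fun z => φ z * ψ z) = cauchyProduct (taylorCoeff K φ) (taylorCoeff K ψ) := by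
  ext q ξ
  have hξ := hV.mem_nhds (hKV ξ.2)
  rw [taylorCoeff, cauchyProduct, iteratedDeriv_fun_mul ((hφ.contDiffOn hV).contDiffAt hξ)
    ((hψ.contDiffOn hV).contDiffAt hξ), Finset.sum_div]
  refine Finset.sum_congr rfl fun k hk => ?_
  have hkq : k ≤ q := Nat.lt_succ_iff.1 (Finset.mem_range.1 hk)
  rw [taylorCoeff, taylorCoeff, Nat.cast_choose ℂ hkq]
  have h₁ : (q.factorial : ℂ) ≠ 0 := Nat.cast_ne_zero.2 q.factorial_ne_zero
  field_simp

lemma measurable_taylorCoeff {K V : Set ℂ} (hV : IsOpen V) (hKV : K ⊆ V) {φ : ℂ → ℂ}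
    (hφ : DifferentiableOn ℂ φ V) (q : ℕ) : Measurable (taylorCoeff K φ q) := by
  have h := ((hφ.iteratedDeriv_of_isOpen hV q).continuousOn.mono hKV).domRestrict
  exact (h.div_const _).measurable

/-- Cauchy's estimates, localized to the points of `A`. -/
lemma taylorBound_indicator_taylorCoeff {K V : Set ℂ} (hV : IsOpen V) (hKV : K ⊆ V) {φ : ℂ → ℂ}
    (hφ : DifferentiableOn ℂ φ V) {A : Set K} (hA : MeasurableSet A) {r M : ℝ} (hr : 0 < r)
    (hM0 : 0 ≤ M) (hball : ∀ ξ ∈ A, Metric.closedBall (ξ : ℂ) r ⊆ V)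
    (hM : ∀ ξ ∈ A, ∀ z ∈ Metric.closedBall (ξ : ℂ) r, ‖φ z‖ ≤ M) :
    TaylorBound r M fun q ξ => A.indicator (fun _ => (1 : ℂ)) ξ * taylorCoeff K φ q ξ := by
  refine ⟨hM0, fun q => (measurable_const.indicator hA).mul (measurable_taylorCoeff hV hKV hφ q),
    fun q ξ => ?_⟩
  by_cases hξ : ξ ∈ A
  · have := Complex.norm_iteratedDeriv_le_of_forall_mem_sphere_norm_le q hr
      ((hφ.mono (hball ξ hξ)).diffContOnCl_ball subset_rfl)
      fun z hz => hM ξ hξ z (Metric.sphere_subset_closedBall hz)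
    have hq : (0 : ℝ) < q.factorial := Nat.cast_pos.2 q.factorial_pos
    rw [Set.indicator_of_mem hξ, one_mul, taylorCoeff, norm_div, Complex.norm_natCast,
      div_le_iff₀ hq]
    refine this.trans (le_of_eq ?_)
    ring
  · rw [Set.indicator_of_notMem hξ, zero_mul, norm_zero]
    positivity

lemma taylorBound_taylorCoeff {K V : Set ℂ} (hV : IsOpen V) (hKV : K ⊆ V) {φ : ℂ → ℂ}
    (hφ : DifferentiableOn ℂ φ V) {r M : ℝ} (hr : 0 < r) (hM0 : 0 ≤ M)
    (hball : ∀ ξ ∈ K, Metric.closedBall ξ r ⊆ V)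
    (hM : ∀ ξ ∈ K, ∀ z ∈ Metric.closedBall ξ r, ‖φ z‖ ≤ M) :
    TaylorBound r M (taylorCoeff K φ) := by
  have := taylorBound_indicator_taylorCoeff hV hKV hφ (A := Set.univ) MeasurableSet.univ hr hM0
    (fun ξ _ => hball ξ ξ.2) (fun ξ _ => hM ξ ξ.2)
  simpa only [Set.indicator_univ, one_mul] using this

/-! ### Holomorphic functional calculus -/

/-- Functions that are holomorphic and bounded on the open `2r`-neighbourhood of `K`. The discs of
radius `r` about points of `K` lie in this neighbourhood, so Cauchy's estimates apply to them. -/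
structure BoundedHolomorphicNear (K : Set ℂ) (r : ℝ) (φ : ℂ → ℂ) : Prop where
  differentiableOn : DifferentiableOn ℂ φ (Metric.thickening (2 * r) K)
  bounded : ∃ M, ∀ z ∈ Metric.thickening (2 * r) K, ‖φ z‖ ≤ M

lemma closedBall_subset_thickening {K : Set ℂ} {r : ℝ} (hr : 0 < r) {ξ : ℂ} (hξ : ξ ∈ K) :
    Metric.closedBall ξ r ⊆ Metric.thickening (2 * r) K :=
  (Metric.closedBall_subset_ball (by linarith)).trans (Metric.ball_subset_thickening hξ _)

namespace BoundedHolomorphicNear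

variable {K : Set ℂ} {r : ℝ} {φ ψ : ℂ → ℂ}

lemma const (c : ℂ) : BoundedHolomorphicNear K r fun _ => c :=
  ⟨differentiableOn_const c, ‖c‖, fun _ _ => le_rfl⟩

lemma mul (hφ : BoundedHolomorphicNear K r φ) (hψ : BoundedHolomorphicNear K r ψ) :
    BoundedHolomorphicNear K r fun z => φ z * ψ z := by
  obtain ⟨M, hM⟩ := hφ.bounded
  obtain ⟨M', hM'⟩ := hψ.bounded
  refine ⟨hφ.differentiableOn.mul hψ.differentiableOn, M * M', fun z hz => ?_⟩
  rw [norm_mul]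
  exact mul_le_mul (hM z hz) (hM' z hz) (norm_nonneg _) ((norm_nonneg _).trans (hM z hz))

lemma pow (hφ : BoundedHolomorphicNear K r φ) (n : ℕ) :
    BoundedHolomorphicNear K r fun z => φ z ^ n := by
  induction n with
  | zero => simpa using const 1
  | succ n ih => simpa only [pow_succ] using ih.mul hφ

lemma sub_const (hK : Bornology.IsBounded K) (a : ℂ) :
    BoundedHolomorphicNear K r fun z => z - a := by
  refine ⟨differentiableOn_id.sub_const a, ?_⟩
  obtain ⟨M, hM⟩ := hK.thickening (δ := 2 * r) |>.exists_norm_le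
  exact ⟨M + ‖a‖, fun z hz => (norm_sub_le _ _).trans (by linarith [hM z hz])⟩

lemma exists_taylorBound (hr : 0 < r) (hφ : BoundedHolomorphicNear K r φ) :
    ∃ M, TaylorBound r M (taylorCoeff K φ) := by
  obtain ⟨M, hM⟩ := hφ.bounded
  exact ⟨max M 0, taylorBound_taylorCoeff Metric.isOpen_thickening
    (Metric.self_subset_thickening (by linarith) K) hφ.differentiableOn hr (le_max_right _ _)
    (fun ξ hξ => closedBall_subset_thickening hr hξ)
    fun ξ hξ z hz => (hM z (closedBall_subset_thickening hr hξ hz)).trans (le_max_left _ _)⟩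

end BoundedHolomorphicNear

namespace SpectralDecomposition

variable {H : Type*} [NormedAddCommGroup H] [NormedSpace ℂ H] {X : H →L[ℂ] H}

/-- The holomorphic functional calculus `φ ↦ φ(X_P + ν)`: for `ν = X_N` it is `φ(X)`, for `ν = 0`
it is `φ(X_P)`. -/
noncomputable def calculus (D : SpectralDecomposition X) (ν : H →L[ℂ] H) (φ : ℂ → ℂ) :
    H →L[ℂ] H :=
  D.E.powerIntegral ν (taylorCoeff (spectrum ℂ X) φ)

variable [CompleteSpace H]

lemma calculus_const (D : SpectralDecomposition X) (ν : H →L[ℂ] H) (c : ℂ) :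
    D.calculus ν (fun _ => c) = c • 1 := by
  have h0 : taylorCoeff (spectrum ℂ X) (fun _ => c) 0 = fun _ => c := by
    ext ξ
    simp [taylorCoeff]
  have hq : ∀ q, q ≠ 0 → taylorCoeff (spectrum ℂ X) (fun _ => c) q = fun _ => 0 := by
    intro q hq
    ext ξ
    simp [taylorCoeff, iteratedDeriv_const, hq]
  rw [calculus, SpectralMeasure.powerIntegral, tsum_eq_single 0]
  · rw [h0, D.E.scalarIntegral_const, pow_zero, one_mul]
  · intro q hq0
    rw [hq q hq0, D.E.scalarIntegral_const, zero_smul, mul_zero]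

lemma calculus_sub_const (D : SpectralDecomposition X) (ν : H →L[ℂ] H) (a : ℂ) :
    D.calculus ν (fun z => z - a) = D.projPart + ν - a • 1 := by
  have hd : deriv (fun z : ℂ => z - a) = fun _ => 1 := by
    ext z
    simp
  have h0 : taylorCoeff (spectrum ℂ X) (fun z => z - a) 0
      = fun ξ : spectrum ℂ X => (ξ : ℂ) - a := by
    ext ξ
    simp [taylorCoeff]
  have h1 : taylorCoeff (spectrum ℂ X) (fun z => z - a) 1 = fun _ => 1 := by
    ext ξ
    rw [taylorCoeff, iteratedDeriv_succ', hd]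
    simp
  have hq : ∀ q, 2 ≤ q → taylorCoeff (spectrum ℂ X) (fun z => z - a) q = fun _ => 0 := by
    intro q hq
    obtain ⟨k, rfl⟩ := Nat.exists_eq_add_of_le' hq
    ext ξ
    rw [taylorCoeff, iteratedDeriv_succ', hd]
    simp [iteratedDeriv_const]
  rw [calculus, SpectralMeasure.powerIntegral, tsum_eq_sum (s := Finset.range 2)]
  · rw [Finset.sum_range_succ, Finset.sum_range_one, h0, h1, D.E.scalarIntegral_const,
      D.E.scalarIntegral_sub (boundedMeasurable_coe X) (.const a), D.E.scalarIntegral_const,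
      projPart_eq, pow_zero, one_mul, pow_one, one_smul, mul_one]
    abel
  · intro q hq0
    rw [hq q (not_lt.1 fun h => hq0 (Finset.mem_range.2 h)), D.E.scalarIntegral_const, zero_smul, mul_zero]

variable {r : ℝ} {φ ψ : ℂ → ℂ}

lemma calculus_mul (D : SpectralDecomposition X) {ν : H →L[ℂ] H}
    (hν : D.E.CommutingQuasinilpotent ν) (hr : 0 < r)
    (hφ : BoundedHolomorphicNear (spectrum ℂ X) r φ)
    (hψ : BoundedHolomorphicNear (spectrum ℂ X) r ψ) :
    D.calculus ν (fun z => φ z * ψ z) = D.calculus ν φ * D.calculus ν ψ := by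
  obtain ⟨M, hM⟩ := hφ.exists_taylorBound hr
  obtain ⟨M', hM'⟩ := hψ.exists_taylorBound hr
  rw [calculus, taylorCoeff_mul Metric.isOpen_thickening
    (Metric.self_subset_thickening (by linarith) _) hφ.differentiableOn hψ.differentiableOn,
    hν.powerIntegral_cauchyProduct hr hM hr hM']
  rfl

lemma calculus_pow (D : SpectralDecomposition X) {ν : H →L[ℂ] H}
    (hν : D.E.CommutingQuasinilpotent ν) (hr : 0 < r)
    (hφ : BoundedHolomorphicNear (spectrum ℂ X) r φ) (n : ℕ) :
    D.calculus ν (fun z => φ z ^ n) = D.calculus ν φ ^ n := by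
  induction n with
  | zero => simpa using D.calculus_const ν 1
  | succ n ih =>
    simp only [pow_succ]
    rw [D.calculus_mul hν hr (hφ.pow n) hφ, ih]

lemma commute_calculus (D : SpectralDecomposition X) {ν : H →L[ℂ] H}
    (hν : D.E.CommutingQuasinilpotent ν) (hr : 0 < r)
    (hφ : BoundedHolomorphicNear (spectrum ℂ X) r φ)
    (hψ : BoundedHolomorphicNear (spectrum ℂ X) r ψ) :
    Commute (D.calculus ν φ) (D.calculus ν ψ) := by
  rw [commute_iff_eq, ← D.calculus_mul hν hr hφ hψ, ← D.calculus_mul hν hr hψ hφ]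
  simp only [mul_comm]

end SpectralDecomposition

/-- A telescoping series: the solution `∑ U^n E (V - U) W^(n+1) = E` of a Sylvester equation,
where `W` is a right inverse of `V`. -/
lemma hasSum_pow_mul_sub_mul_pow {A : Type*} [NormedRing A] [CompleteSpace A] {U V W E : A}
    (hU : Commute U E) (hVW : V * W = 1) {x y C₁ C₂ : ℝ} (hx : 0 ≤ x) (hy : 0 ≤ y)
    (hxy : x * y < 1) (hC₁ : 0 ≤ C₁) (h₁ : ∀ n : ℕ, ‖U ^ n * E‖ ≤ C₁ * x ^ n)
    (h₂ : ∀ n : ℕ, ‖W ^ n‖ ≤ C₂ * y ^ n) :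
    HasSum (fun n : ℕ => U ^ n * E * (U - V) * W ^ (n + 1)) (-E) := by
  have hs : Summable fun n : ℕ => U ^ n * E * W ^ n := by
    refine Summable.of_norm_bounded
      ((summable_geometric_of_lt_one (mul_nonneg hx hy) hxy).mul_left (C₁ * C₂)) fun n => ?_
    calc _ ≤ (C₁ * x ^ n) * (C₂ * y ^ n) := (norm_mul_le _ _).trans
          (mul_le_mul (h₁ n) (h₂ n) (norm_nonneg _) (by positivity))
      _ = C₁ * C₂ * (x * y) ^ n := by rw [mul_pow]; ring
  have h := ((hasSum_nat_add_iff' 1).2 hs.hasSum).sub hs.hasSum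
  simp only [Finset.sum_range_one, pow_zero, one_mul, mul_one] at h
  convert! h using 1
  · ext n
    have e₁ : U ^ n * E * U = U ^ (n + 1) * E := by rw [mul_assoc, ← hU.eq, ← mul_assoc, pow_succ]
    have e₂ : V * W ^ (n + 1) = W ^ n := by rw [pow_succ', ← mul_assoc, hVW, one_mul]
    rw [mul_sub, sub_mul, e₁, mul_assoc _ V, e₂]
  · abel

/-- For a finite first factor, a summable family on a product can be summed fibre by fibre. -/
lemma Summable.hasSum_prod_fintype {β γ F : Type*} [Fintype β] [NormedAddCommGroup F]
    {u : β × γ → F} (hs : Summable u) {g : β → F}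
    (hg : ∀ b, HasSum (fun c => u (b, c)) (g b)) : HasSum u (∑ b, g b) := by
  have h := hs.hasSum.prod_fiberwise hg
  rw [← h.unique (hasSum_fintype g)]
  exact hs.hasSum

/-! ### Geometry of the divided difference -/

/-- The geometry behind the expansion of the divided difference of `f` on `K₁ × K₂`: the
`2r`-neighbourhoods of `K₁` and `K₂` are far apart, and `f` is holomorphic and bounded by `B` on
both of them. -/
structure DividedDiffDomain (f : ℂ → ℂ) (K₁ K₂ : Set ℂ) (r B : ℝ) : Prop where
  r_pos : 0 < r
  one_le : 1 ≤ B
  differentiableOn₁ : DifferentiableOn ℂ f (Metric.thickening (2 * r) K₁)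
  differentiableOn₂ : DifferentiableOn ℂ f (Metric.thickening (2 * r) K₂)
  norm_le₁ : ∀ z ∈ Metric.thickening (2 * r) K₁, ‖f z‖ ≤ B
  norm_le₂ : ∀ z ∈ Metric.thickening (2 * r) K₂, ‖f z‖ ≤ B
  le_norm_sub : ∀ z₁ ∈ K₁, ∀ z₂ ∈ K₂, 8 * r ≤ ‖z₂ - z₁‖

lemma exists_dividedDiffDomain {f : ℂ → ℂ} {U K₁ K₂ : Set ℂ} (hU : IsOpen U)
    (hf : DifferentiableOn ℂ f U) (h₁ : IsCompact K₁) (h₂ : IsCompact K₂) (hK₁ : K₁ ⊆ U)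
    (hK₂ : K₂ ⊆ U) (hd : Disjoint K₁ K₂) : ∃ r B, DividedDiffDomain f K₁ K₂ r B := by
  obtain ⟨δ, hδ, hδU⟩ :=
    (h₁.union h₂).exists_cthickening_subset_open hU (Set.union_subset hK₁ hK₂)
  obtain ⟨δ', hδ', hdis⟩ := hd.exists_thickenings h₁ h₂.isClosed
  obtain ⟨B, hB⟩ := ((h₁.union h₂).cthickening (r := δ)).exists_bound_of_continuousOn
    (hf.continuousOn.mono hδU)
  have hr : 0 < min δ δ' / 8 := by positivity
  have hrδ : 2 * (min δ δ' / 8) ≤ δ := by linarith [min_le_left δ δ']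
  have hsub : ∀ K ⊆ K₁ ∪ K₂, Metric.thickening (2 * (min δ δ' / 8)) K
      ⊆ Metric.cthickening δ (K₁ ∪ K₂) := fun K hK =>
    (Metric.thickening_subset_cthickening_of_le hrδ K).trans (Metric.cthickening_subset_of_subset δ hK)
  -- Points at distance less than `δ'` would lie in both of the disjoint thickenings.
  refine ⟨min δ δ' / 8, max B 1, hr, le_max_right _ _,
    hf.mono ((hsub _ Set.subset_union_left).trans hδU),
    hf.mono ((hsub _ Set.subset_union_right).trans hδU),
    fun z hz => (hB z (hsub _ Set.subset_union_left hz)).trans (le_max_left _ _),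
    fun z hz => (hB z (hsub _ Set.subset_union_right hz)).trans (le_max_left _ _),
    fun z₁ hz₁ z₂ hz₂ => ?_⟩
  by_contra! hlt
  have hlt' : dist z₂ z₁ < δ' := by
    rw [dist_eq_norm]
    linarith [min_le_right δ δ']
  exact Set.disjoint_left.1 hdis (Metric.mem_thickening_iff.2 ⟨z₁, hz₁, hlt'⟩)
    (Metric.self_subset_thickening hδ' _ hz₂)

/-- First factors of the expansion of the divided difference about `a`: `f(z) (z - a)^n` for `true`
and `(z - a)^n` for `false`. -/
noncomputable def factor₁ (f : ℂ → ℂ) (a : ℂ) (b : Bool) (n : ℕ) (z : ℂ) : ℂ :=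
  (bif b then f z else 1) * (z - a) ^ n

/-- Second factors of the expansion of the divided difference about `a`: `-(z - a)^(-(n + 1))` for
`true` and `f(z) (z - a)^(-(n + 1))` for `false`. -/
noncomputable def factor₂ (f : ℂ → ℂ) (a : ℂ) (b : Bool) (n : ℕ) (z : ℂ) : ℂ :=
  (bif b then -1 else f z) * (z - a)⁻¹ ^ (n + 1)

/-! ### Expansion of the divided difference -/

lemma summable_comp_snd {β γ : Type*} [Finite β] {g : γ → ℝ} (hg : Summable g)
    (hg0 : ∀ c, 0 ≤ g c) : Summable fun i : β × γ => g i.2 := by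
  have h1 : Summable fun _ : β => (1 : ℝ) := Summable.of_finite
  simpa using h1.mul_of_nonneg hg (fun _ => zero_le_one) hg0

namespace DividedDiffDomain

variable {f : ℂ → ℂ} {K₁ K₂ : Set ℂ} {r B : ℝ}

lemma le_norm_sub_of_mem_thickening (h : DividedDiffDomain f K₁ K₂ r B) {a z : ℂ} (ha : a ∈ K₁)
    (hz : z ∈ Metric.thickening (2 * r) K₂) : 6 * r ≤ ‖z - a‖ := by
  obtain ⟨w, hw, hzw⟩ := Metric.mem_thickening_iff.1 hz
  have h1 := h.le_norm_sub a ha w hw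
  rw [dist_comm, dist_eq_norm] at hzw
  have h2 : ‖w - a‖ ≤ ‖w - z‖ + ‖z - a‖ := by
    rw [← sub_add_sub_cancel w z a]
    exact norm_add_le _ _
  linarith

lemma sub_ne_zero (h : DividedDiffDomain f K₁ K₂ r B) {a z : ℂ} (ha : a ∈ K₁)
    (hz : z ∈ Metric.thickening (2 * r) K₂) : z - a ≠ 0 := by
  have h1 := h.le_norm_sub_of_mem_thickening ha hz
  have := h.r_pos
  exact norm_pos_iff.1 (by linarith)

lemma norm_inv_sub_le (h : DividedDiffDomain f K₁ K₂ r B) {a z : ℂ} (ha : a ∈ K₁)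
    (hz : z ∈ Metric.thickening (2 * r) K₂) : ‖(z - a)⁻¹‖ ≤ (6 * r)⁻¹ := by
  have := h.r_pos
  rw [norm_inv]
  exact inv_anti₀ (by positivity) (h.le_norm_sub_of_mem_thickening ha hz)

lemma boundedHolomorphicNear₁ (h : DividedDiffDomain f K₁ K₂ r B) :
    BoundedHolomorphicNear K₁ r f := ⟨h.differentiableOn₁, B, h.norm_le₁⟩

lemma boundedHolomorphicNear₂ (h : DividedDiffDomain f K₁ K₂ r B) :
    BoundedHolomorphicNear K₂ r f := ⟨h.differentiableOn₂, B, h.norm_le₂⟩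

lemma boundedHolomorphicNear_inv_sub (h : DividedDiffDomain f K₁ K₂ r B) {a : ℂ} (ha : a ∈ K₁) :
    BoundedHolomorphicNear K₂ r fun z => (z - a)⁻¹ :=
  ⟨(differentiableOn_id.sub_const a).inv fun _ hz => h.sub_ne_zero ha hz, _,
    fun _ hz => h.norm_inv_sub_le ha hz⟩

lemma norm_factor₁_le (h : DividedDiffDomain f K₁ K₂ r B) {a z : ℂ} (b : Bool) (n : ℕ)
    (hz : z ∈ Metric.thickening (2 * r) K₁) (hza : ‖z - a‖ ≤ 3 * r) :
    ‖factor₁ f a b n z‖ ≤ B * (3 * r) ^ n := by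
  have hB : 0 ≤ B := zero_le_one.trans h.one_le
  rw [factor₁, norm_mul, norm_pow]
  refine mul_le_mul ?_ (pow_le_pow_left₀ (norm_nonneg _) hza n) (by positivity) hB
  cases b
  · simpa using h.one_le
  · exact h.norm_le₁ z hz

lemma norm_factor₂_le (h : DividedDiffDomain f K₁ K₂ r B) {a z : ℂ} (ha : a ∈ K₁) (b : Bool)
    (n : ℕ) (hz : z ∈ Metric.thickening (2 * r) K₂) :
    ‖factor₂ f a b n z‖ ≤ B * (6 * r)⁻¹ ^ (n + 1) := by
  have hB : 0 ≤ B := zero_le_one.trans h.one_le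
  rw [factor₂, norm_mul, norm_pow]
  refine mul_le_mul ?_ (pow_le_pow_left₀ (norm_nonneg _) (h.norm_inv_sub_le ha hz) _)
    (by positivity) hB
  cases b
  · exact h.norm_le₂ z hz
  · simpa using h.one_le

lemma differentiableOn_factor₁ (h : DividedDiffDomain f K₁ K₂ r B) (a : ℂ) (b : Bool) (n : ℕ) :
    DifferentiableOn ℂ (factor₁ f a b n) (Metric.thickening (2 * r) K₁) := by
  refine DifferentiableOn.mul ?_ ((differentiableOn_id.sub_const a).pow n)
  cases b
  · exact differentiableOn_const _
  · exact h.differentiableOn₁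

lemma differentiableOn_factor₂ (h : DividedDiffDomain f K₁ K₂ r B) {a : ℂ} (ha : a ∈ K₁)
    (b : Bool) (n : ℕ) :
    DifferentiableOn ℂ (factor₂ f a b n) (Metric.thickening (2 * r) K₂) := by
  refine DifferentiableOn.mul ?_ ((h.boundedHolomorphicNear_inv_sub ha).differentiableOn.pow _)
  cases b
  · exact h.differentiableOn₂
  · exact differentiableOn_const _

lemma summable_bound (h : DividedDiffDomain f K₁ K₂ r B) :
    Summable fun n : ℕ => (B * (3 * r) ^ n) * (B * (6 * r)⁻¹ ^ (n + 1)) := by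
  have hr := h.r_pos
  have e : (3 * r) * (6 * r)⁻¹ = 1 / 2 := by
    field_simp
    norm_num
  refine (summable_geometric_two.mul_left (B * B * (6 * r)⁻¹)).congr fun n => ?_
  rw [← e, mul_pow]
  ring

lemma summable_bound_prod (h : DividedDiffDomain f K₁ K₂ r B) (β : Type*) [Finite β] :
    Summable fun i : β × ℕ => (B * (3 * r) ^ i.2) * (B * (6 * r)⁻¹ ^ (i.2 + 1)) := by
  have hr := h.r_pos
  have hB : 0 ≤ B := zero_le_one.trans h.one_le
  exact summable_comp_snd h.summable_bound fun n => by positivity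

/-- The expansion `f^{[1]}(w₁, w₂) = -∑ (f(w₁) - f(w₂)) (w₁ - a)^n (w₂ - a)^(-(n + 1))`. -/
lemma hasSum_dividedDiff (h : DividedDiffDomain f K₁ K₂ r B) {a w₁ w₂ : ℂ} (ha : a ∈ K₁)
    (hw₁ : w₁ ∈ Metric.thickening (2 * r) K₁) (hwa : ‖w₁ - a‖ ≤ 3 * r)
    (hw₂ : w₂ ∈ Metric.thickening (2 * r) K₂) :
    HasSum (fun i : Bool × ℕ => factor₁ f a i.1 i.2 w₁ * factor₂ f a i.1 i.2 w₂)
      (dividedDiff f w₁ w₂) := by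
  have hB : 0 ≤ B := zero_le_one.trans h.one_le
  have hr := h.r_pos
  have hv := h.le_norm_sub_of_mem_thickening ha hw₂
  have hv0 := h.sub_ne_zero ha hw₂
  have hne : w₂ - w₁ ≠ 0 := by
    intro h0
    rw [sub_eq_zero.1 h0] at hv
    linarith
  have hgeom : HasSum (fun n : ℕ => (w₁ - a) ^ n * (w₂ - a)⁻¹ ^ (n + 1)) (w₂ - w₁)⁻¹ := by
    have hlt : ‖(w₁ - a) * (w₂ - a)⁻¹‖ < 1 := by
      rw [← div_eq_mul_inv, norm_div, div_lt_one (by linarith)]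
      linarith
    convert! (hasSum_geometric_of_norm_lt_one hlt).mul_right (w₂ - a)⁻¹ using 1
    · ext n
      rw [mul_pow]
      ring
    · rw [← mul_inv, sub_mul, mul_assoc, inv_mul_cancel₀ hv0]
      congr 1
      ring
  have hs : Summable fun i : Bool × ℕ => factor₁ f a i.1 i.2 w₁ * factor₂ f a i.1 i.2 w₂ := by
    refine Summable.of_norm_bounded (h.summable_bound_prod Bool) fun i => ?_
    rw [norm_mul]
    exact mul_le_mul (h.norm_factor₁_le _ _ hw₁ hwa) (h.norm_factor₂_le ha _ _ hw₂)
      (norm_nonneg _) (by positivity)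
  have hg : ∀ b : Bool, HasSum (fun n : ℕ => factor₁ f a b n w₁ * factor₂ f a b n w₂)
      ((bif b then -f w₁ else f w₂) * (w₂ - w₁)⁻¹) := by
    intro b
    refine (hgeom.mul_left (bif b then -f w₁ else f w₂)).congr_fun fun n => ?_
    cases b <;> simp only [factor₁, factor₂, cond_true, cond_false] <;> ring
  have := hs.hasSum_prod_fintype hg
  convert! this using 1
  have hne' : w₁ - w₂ ≠ 0 := by
    rw [← neg_sub]
    exact neg_ne_zero.2 hne
  rw [Fintype.sum_bool, dividedDiff, cond_true, cond_false]
  field_simp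
  ring

/-- The coefficients of the expansion about `a`, localized in the first variable to a set `A` of
points at distance at most `r` from `a`. -/
lemma taylorBound₁ (h : DividedDiffDomain f K₁ K₂ r B) {a : ℂ} {A : Set K₁}
    (hA : MeasurableSet A) (hAa : ∀ ξ ∈ A, ‖(ξ : ℂ) - a‖ ≤ r) (b : Bool) (n : ℕ) :
    TaylorBound r (B * (3 * r) ^ n)
      fun q ξ => A.indicator (fun _ => (1 : ℂ)) ξ * taylorCoeff K₁ (factor₁ f a b n) q ξ := by
  have hB : 0 ≤ B := zero_le_one.trans h.one_le
  have hr := h.r_pos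
  refine taylorBound_indicator_taylorCoeff Metric.isOpen_thickening
    (Metric.self_subset_thickening (by positivity) _) (h.differentiableOn_factor₁ a b n) hA hr
    (by positivity) (fun ξ _ => closedBall_subset_thickening hr ξ.2) fun ξ hξ z hz => ?_
  refine h.norm_factor₁_le b n (closedBall_subset_thickening hr ξ.2 hz) ?_
  rw [Metric.mem_closedBall, dist_eq_norm] at hz
  have := hAa ξ hξ
  rw [← sub_add_sub_cancel z (ξ : ℂ) a]
  refine (norm_add_le _ _).trans ?_
  linarith

lemma taylorBound₂ (h : DividedDiffDomain f K₁ K₂ r B) {a : ℂ} (ha : a ∈ K₁) (b : Bool) (n : ℕ) :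
    TaylorBound r (B * (6 * r)⁻¹ ^ (n + 1)) (taylorCoeff K₂ (factor₂ f a b n)) := by
  have hB : 0 ≤ B := zero_le_one.trans h.one_le
  have hr := h.r_pos
  exact taylorBound_taylorCoeff Metric.isOpen_thickening
    (Metric.self_subset_thickening (by positivity) _) (h.differentiableOn_factor₂ ha b n) hr
    (by positivity) (fun ξ hξ => closedBall_subset_thickening hr hξ)
    fun ξ hξ z hz => h.norm_factor₂_le ha b n (closedBall_subset_thickening hr hξ hz)

/-- The Taylor coefficients of the divided difference at `(ξ₁, ξ₂)` are obtained from the expansion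
about the tag of `ξ₁`; the expansions about the other tags are cut off by the indicators. -/
lemma hasSum_mixedDeriv_dividedDiff (h : DividedDiffDomain f K₁ K₂ r B) (p : TaggedPartition K₁)
    (hp : ∀ ξ : K₁, ‖(ξ : ℂ) - p.tag ξ‖ ≤ r) (ξ₁ : K₁) (ξ₂ : K₂) (q₁ q₂ : ℕ) :
    HasSum (fun i : (p.tags × Bool) × ℕ =>
        ((p.cell i.1.1).indicator (fun _ => (1 : ℂ)) ξ₁ *
          taylorCoeff K₁ (factor₁ f (i.1.1 : K₁) i.1.2 i.2) q₁ ξ₁) *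
        taylorCoeff K₂ (factor₂ f (i.1.1 : K₁) i.1.2 i.2) q₂ ξ₂)
      (mixedDeriv (dividedDiff f) q₁ q₂ ξ₁ ξ₂ / ((q₁.factorial : ℂ) * (q₂.factorial : ℂ))) := by
  have hr := h.r_pos
  set a : p.tags := ⟨p.tag ξ₁, p.tag_mem_tags ξ₁⟩ with ha
  let k : Bool × ℕ → (p.tags × Bool) × ℕ := fun j => ((a, j.1), j.2)
  have hk : Function.Injective k := by
    rintro ⟨b, n⟩ ⟨b', n'⟩ hj
    simpa [k] using hj
  rw [← hk.hasSum_iff]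
  · have hsub₁ : Metric.ball (ξ₁ : ℂ) (2 * r) ⊆ Metric.thickening (2 * r) K₁ :=
      Metric.ball_subset_thickening ξ₁.2 _
    have hwa : ∀ w ∈ Metric.ball (ξ₁ : ℂ) (2 * r), ‖w - (p.tag ξ₁ : ℂ)‖ ≤ 3 * r := by
      intro w hw
      rw [Metric.mem_ball, dist_eq_norm] at hw
      rw [← sub_add_sub_cancel w (ξ₁ : ℂ)]
      refine (norm_add_le _ _).trans ?_
      linarith [hp ξ₁]
    have main := hasSum_mixedDeriv Metric.isOpen_ball Metric.isOpen_thickening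
      (V₁ := Metric.ball (ξ₁ : ℂ) (2 * r)) (V₂ := Metric.thickening (2 * r) K₂)
      (φ := fun i : Bool × ℕ => factor₁ f (p.tag ξ₁) i.1 i.2)
      (ψ := fun i : Bool × ℕ => factor₂ f (p.tag ξ₁) i.1 i.2) (h.summable_bound_prod Bool)
      (fun i => (h.differentiableOn_factor₁ _ _ _).mono hsub₁)
      (fun i => h.differentiableOn_factor₂ (p.tag ξ₁).2 _ _)
      (fun i z hz => h.norm_factor₁_le _ _ (hsub₁ hz) (hwa z hz))
      (fun i z hz => h.norm_factor₂_le (p.tag ξ₁).2 _ _ hz)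
      (fun w₁ hw₁ w₂ hw₂ => h.hasSum_dividedDiff (p.tag ξ₁).2 (hsub₁ hw₁) (hwa w₁ hw₁) hw₂)
      q₁ q₂ (Metric.mem_ball_self (by positivity))
      (Metric.self_subset_thickening (by positivity) _ ξ₂.2)
    refine (main.div_const _).congr_fun fun j => ?_
    have hmem : ξ₁ ∈ p.cell (a : K₁) := rfl
    simp only [Function.comp_apply, k, Set.indicator_of_mem hmem, taylorCoeff, one_mul]
    rw [div_mul_div_comm]
  · intro i hi
    have : ξ₁ ∉ p.cell (i.1.1 : K₁) := by
      intro hmem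
      refine hi ⟨(i.1.2, i.2), ?_⟩
      have : a = i.1.1 := Subtype.ext hmem
      simp [k, this]
    rw [Set.indicator_of_notMem this, zero_mul, zero_mul]

end DividedDiffDomain

/-! ### Operator form of the divided difference identity -/

/-- The first coefficient arrays of the expansion of the divided difference subordinate to a
partition, indexed by a tag, the choice of one of the two terms, and the exponent. -/
noncomputable def dividedDiffCoeff₁ {K : Set ℂ} (f : ℂ → ℂ) (p : TaggedPartition K)
    (i : (p.tags × Bool) × ℕ) : ℕ → K → ℂ :=
  fun q ξ => (p.cell i.1.1).indicator (fun _ => (1 : ℂ)) ξ *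
    taylorCoeff K (factor₁ f (i.1.1 : K) i.1.2 i.2) q ξ

/-- The second coefficient arrays of the expansion of the divided difference subordinate to a
partition. -/
noncomputable def dividedDiffCoeff₂ {K : Set ℂ} (L : Set ℂ) (f : ℂ → ℂ) (p : TaggedPartition K)
    (i : (p.tags × Bool) × ℕ) : ℕ → L → ℂ :=
  taylorCoeff L (factor₂ f (i.1.1 : K) i.1.2 i.2)

lemma norm_sub_le_of_mem_cell {K : Set ℂ} {p : TaggedPartition K} {r : ℝ}
    (hp : ∀ ξ : K, ‖(ξ : ℂ) - p.tag ξ‖ ≤ r) {a ξ : K} (hξ : ξ ∈ p.cell a) :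
    ‖(ξ : ℂ) - a‖ ≤ r := by
  have h : p.tag ξ = a := hξ
  rw [← h]
  exact hp ξ

section

variable {H : Type*} [NormedAddCommGroup H] [NormedSpace ℂ H] [CompleteSpace H] {X₁ X₂ : H →L[ℂ] H}
  {f : ℂ → ℂ} {r B : ℝ}

namespace DividedDiffDomain

lemma powerIntegral_dividedDiffCoeff₁ {K₂ : Set ℂ} (D : SpectralDecomposition X₁)
    (h : DividedDiffDomain f (spectrum ℂ X₁) K₂ r B) (p : TaggedPartition (spectrum ℂ X₁))
    {ν : H →L[ℂ] H} (hν : D.E.CommutingQuasinilpotent ν) (a : p.tags) (b : Bool) (n : ℕ) :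
    D.E.powerIntegral ν (dividedDiffCoeff₁ f p ((a, b), n))
      = (bif b then D.calculus ν f else 1) *
        (D.calculus ν (fun z => z - (a : spectrum ℂ X₁)) ^ n * D.E.proj (p.cell a)) := by
  have hr := h.r_pos
  have hu : BoundedHolomorphicNear (spectrum ℂ X₁) r fun z => z - (a : spectrum ℂ X₁) :=
    .sub_const (spectrum.isBounded X₁) _
  have hφ : BoundedHolomorphicNear (spectrum ℂ X₁) r fun z => (bif b then f z else 1) := by
    cases b
    · exact .const 1
    · exact h.boundedHolomorphicNear₁
  obtain ⟨M, hM⟩ := (hφ.mul (hu.pow n)).exists_taylorBound hr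
  have e₁ := hν.powerIntegral_indicator_mul hr hM (p.measurableSet_cell a)
  have e₂ := D.calculus_mul hν hr hφ (hu.pow n)
  rw [D.calculus_pow hν hr hu] at e₂
  have e₃ : D.calculus ν (fun z => (bif b then f z else 1)) = bif b then D.calculus ν f else 1 := by
    cases b
    · simpa using D.calculus_const ν 1
    · rfl
  rw [e₃] at e₂
  rw [← mul_assoc, ← e₂]
  exact e₁

lemma powerIntegral_dividedDiffCoeff₂ {K₁ : Set ℂ} (D : SpectralDecomposition X₂)
    (h : DividedDiffDomain f K₁ (spectrum ℂ X₂) r B) (p : TaggedPartition K₁)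
    {ν : H →L[ℂ] H} (hν : D.E.CommutingQuasinilpotent ν) (a : p.tags) (b : Bool) (n : ℕ) :
    D.E.powerIntegral ν (dividedDiffCoeff₂ (spectrum ℂ X₂) f p ((a, b), n))
      = D.calculus ν (fun z => (z - (a : K₁))⁻¹) ^ (n + 1) *
        (bif b then -1 else D.calculus ν f) := by
  have hr := h.r_pos
  have hw := h.boundedHolomorphicNear_inv_sub (a : K₁).2
  have hψ : BoundedHolomorphicNear (spectrum ℂ X₂) r fun z => (bif b then -1 else f z) := by
    cases b
    · exact h.boundedHolomorphicNear₂
    · exact .const (-1)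
  have e₂ := D.calculus_mul hν hr hψ (hw.pow (n + 1))
  rw [(D.commute_calculus hν hr hψ (hw.pow (n + 1))).eq, D.calculus_pow hν hr hw] at e₂
  have e₃ : D.calculus ν (fun z => (bif b then -1 else f z))
      = bif b then -1 else D.calculus ν f := by
    cases b
    · rfl
    · simpa using D.calculus_const ν (-1)
  rw [e₃] at e₂
  exact e₂

lemma calculus_sub_mul_calculus_inv_sub {K₁ : Set ℂ} (D : SpectralDecomposition X₂)
    (h : DividedDiffDomain f K₁ (spectrum ℂ X₂) r B) {ν : H →L[ℂ] H}
    (hν : D.E.CommutingQuasinilpotent ν) {α : ℂ} (hα : α ∈ K₁) :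
    D.calculus ν (fun z => z - α) * D.calculus ν (fun z => (z - α)⁻¹) = 1 := by
  have hr := h.r_pos
  have hv : BoundedHolomorphicNear (spectrum ℂ X₂) r fun z => z - α :=
    .sub_const (spectrum.isBounded X₂) α
  have hw := h.boundedHolomorphicNear_inv_sub hα
  have e : taylorCoeff (spectrum ℂ X₂) (fun z => (z - α) * (z - α)⁻¹)
      = taylorCoeff (spectrum ℂ X₂) fun _ => 1 := by
    ext q ξ
    rw [taylorCoeff, taylorCoeff]
    congr 1
    refine Filter.EventuallyEq.iteratedDeriv_eq q ?_
    filter_upwards [Metric.isOpen_thickening.mem_nhds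
      (Metric.self_subset_thickening (by positivity : 0 < 2 * r) _ ξ.2)] with z hz
    exact mul_inv_cancel₀ (h.sub_ne_zero hα hz)
  have hone : D.calculus ν (fun _ => 1) = 1 := by simpa using D.calculus_const ν 1
  rw [← D.calculus_mul hν hr hv hw, ← hone, SpectralDecomposition.calculus, e]
  rfl

lemma exists_norm_calculus_sub_pow_mul_proj_le {K₂ : Set ℂ} (D : SpectralDecomposition X₁)
    (h : DividedDiffDomain f (spectrum ℂ X₁) K₂ r B) {ν : H →L[ℂ] H}
    (hν : D.E.CommutingQuasinilpotent ν) {α : ℂ} {A : Set (spectrum ℂ X₁)} (hA : MeasurableSet A)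
    (hAα : ∀ ξ ∈ A, ‖(ξ : ℂ) - α‖ ≤ r) :
    ∃ C, 0 ≤ C ∧ ∀ n : ℕ,
      ‖D.calculus ν (fun z => z - α) ^ n * D.E.proj A‖ ≤ C * (3 * r) ^ n := by
  have hr := h.r_pos
  have hB : 0 ≤ B := zero_le_one.trans h.one_le
  obtain ⟨C, hC, hC'⟩ := hν.exists_norm_powerIntegral_le hr
  have hu : BoundedHolomorphicNear (spectrum ℂ X₁) r fun z => z - α :=
    .sub_const (spectrum.isBounded X₁) α
  refine ⟨C * B, mul_nonneg hC hB, fun n => ?_⟩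
  obtain ⟨M, hM⟩ := (hu.pow n).exists_taylorBound hr
  have e₁ := hν.powerIntegral_indicator_mul hr hM hA
  have e₂ := hC' _ _ (h.taylorBound₁ hA hAα false n)
  have e₃ : factor₁ f α false n = fun z => (z - α) ^ n := by
    ext z
    simp [factor₁]
  rw [e₃, e₁] at e₂
  rw [← D.calculus_pow hν hr hu n, mul_assoc]
  exact e₂

lemma exists_norm_calculus_inv_sub_pow_le {K₁ : Set ℂ} (D : SpectralDecomposition X₂)
    (h : DividedDiffDomain f K₁ (spectrum ℂ X₂) r B) {ν : H →L[ℂ] H}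
    (hν : D.E.CommutingQuasinilpotent ν) {α : ℂ} (hα : α ∈ K₁) :
    ∃ C, ∀ n : ℕ, ‖D.calculus ν (fun z => (z - α)⁻¹) ^ n‖ ≤ C * (6 * r)⁻¹ ^ n := by
  have hr := h.r_pos
  have hw := h.boundedHolomorphicNear_inv_sub hα
  obtain ⟨C, hC, hC'⟩ := hν.exists_norm_powerIntegral_le hr
  refine ⟨C, fun n => ?_⟩
  rw [← D.calculus_pow hν hr hw]
  refine hC' _ _ (taylorBound_taylorCoeff Metric.isOpen_thickening
    (Metric.self_subset_thickening (by positivity) _) (hw.pow n).differentiableOn hr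
    (by positivity) (fun ξ hξ => closedBall_subset_thickening hr hξ) fun ξ hξ z hz => ?_)
  rw [norm_pow]
  exact pow_le_pow_left₀ (norm_nonneg _)
    (h.norm_inv_sub_le hα (closedBall_subset_thickening hr hξ hz)) n

/-- About each tag, the expansion of the divided difference telescopes. -/
lemma hasSum_powerIntegral_fiber (D₁ : SpectralDecomposition X₁) (D₂ : SpectralDecomposition X₂)
    (h : DividedDiffDomain f (spectrum ℂ X₁) (spectrum ℂ X₂) r B)
    (p : TaggedPartition (spectrum ℂ X₁))
    (hp : ∀ ξ : spectrum ℂ X₁, ‖(ξ : ℂ) - p.tag ξ‖ ≤ r) {ν₁ ν₂ : H →L[ℂ] H}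
    (hν₁ : D₁.E.CommutingQuasinilpotent ν₁) (hν₂ : D₂.E.CommutingQuasinilpotent ν₂)
    (a : p.tags) (b : Bool) :
    HasSum (fun n : ℕ => D₁.E.powerIntegral ν₁ (dividedDiffCoeff₁ f p ((a, b), n)) *
        ((D₁.projPart + ν₁) - (D₂.projPart + ν₂)) *
        D₂.E.powerIntegral ν₂ (dividedDiffCoeff₂ (spectrum ℂ X₂) f p ((a, b), n)))
      (bif b then D₁.calculus ν₁ f * D₁.E.proj (p.cell a)
        else -(D₁.E.proj (p.cell a) * D₂.calculus ν₂ f)) := by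
  have hr := h.r_pos
  have haK : ((a : spectrum ℂ X₁) : ℂ) ∈ spectrum ℂ X₁ := a.1.2
  have hcell := p.measurableSet_cell (a : spectrum ℂ X₁)
  have hd := h.powerIntegral_dividedDiffCoeff₁ D₁ p hν₁ a b
  have he := h.powerIntegral_dividedDiffCoeff₂ D₂ p hν₂ a b
  have hVW := h.calculus_sub_mul_calculus_inv_sub D₂ hν₂ haK
  obtain ⟨C₁, hC₁, hUn⟩ := h.exists_norm_calculus_sub_pow_mul_proj_le D₁ hν₁ hcell
    fun ξ hξ => norm_sub_le_of_mem_cell hp hξ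
  obtain ⟨C₂, hWn⟩ := h.exists_norm_calculus_inv_sub_pow_le D₂ hν₂ haK
  have hU := D₁.calculus_sub_const ν₁ (a : spectrum ℂ X₁)
  have hV := D₂.calculus_sub_const ν₂ (a : spectrum ℂ X₁)
  generalize D₁.calculus ν₁ (fun z => z - (a : spectrum ℂ X₁)) = U at *
  generalize D₂.calculus ν₂ (fun z => z - (a : spectrum ℂ X₁)) = V at *
  generalize D₂.calculus ν₂ (fun z => (z - (a : spectrum ℂ X₁))⁻¹) = W at *
  have hYUV : (D₁.projPart + ν₁) - (D₂.projPart + ν₂) = U - V := by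
    rw [hU, hV]
    abel
  have hUE : Commute U (D₁.E.proj (p.cell a)) := by
    rw [hU]
    exact ((D₁.commute_projPart_proj hcell).add_left (hν₁.commute _ hcell)).sub_left
      ((Commute.one_left _).smul_left _)
  have hxy : 3 * r * (6 * r)⁻¹ < 1 := by
    rw [← div_eq_mul_inv, div_lt_one (by positivity)]
    linarith
  have htel := hasSum_pow_mul_sub_mul_pow hUE hVW (by positivity) (by positivity) hxy hC₁ hUn hWn
  simp only [hd, he, hYUV]
  cases b
  · simpa [mul_assoc] using htel.mul_right (D₂.calculus ν₂ f)
  · simpa [mul_assoc] using (htel.mul_left (D₁.calculus ν₁ f)).neg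

/-- The operator form of `f^{[1]}(x₁, x₂) (x₁ - x₂) = f(x₁) - f(x₂)`. -/
lemma hasSum_powerIntegral (D₁ : SpectralDecomposition X₁) (D₂ : SpectralDecomposition X₂)
    (h : DividedDiffDomain f (spectrum ℂ X₁) (spectrum ℂ X₂) r B)
    (p : TaggedPartition (spectrum ℂ X₁))
    (hp : ∀ ξ : spectrum ℂ X₁, ‖(ξ : ℂ) - p.tag ξ‖ ≤ r) {ν₁ ν₂ : H →L[ℂ] H}
    (hν₁ : D₁.E.CommutingQuasinilpotent ν₁) (hν₂ : D₂.E.CommutingQuasinilpotent ν₂) :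
    HasSum (fun i => D₁.E.powerIntegral ν₁ (dividedDiffCoeff₁ f p i) *
        ((D₁.projPart + ν₁) - (D₂.projPart + ν₂)) *
        D₂.E.powerIntegral ν₂ (dividedDiffCoeff₂ (spectrum ℂ X₂) f p i))
      (D₁.calculus ν₁ f - D₂.calculus ν₂ f) := by
  have hr := h.r_pos
  have hB : 0 ≤ B := zero_le_one.trans h.one_le
  obtain ⟨C₁, hC₁, hC₁'⟩ := hν₁.exists_norm_powerIntegral_le hr
  obtain ⟨C₂, hC₂, hC₂'⟩ := hν₂.exists_norm_powerIntegral_le hr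
  have hg := h.hasSum_powerIntegral_fiber D₁ D₂ p hp hν₁ hν₂
  generalize (D₁.projPart + ν₁) - (D₂.projPart + ν₂) = Y at *
  have hs : Summable fun i => D₁.E.powerIntegral ν₁ (dividedDiffCoeff₁ f p i) * Y *
      D₂.E.powerIntegral ν₂ (dividedDiffCoeff₂ (spectrum ℂ X₂) f p i) := by
    refine Summable.of_norm_bounded
      ((h.summable_bound_prod (p.tags × Bool)).mul_left (C₁ * ‖Y‖ * C₂)) fun i => ?_
    calc _ ≤ (C₁ * (B * (3 * r) ^ i.2)) * ‖Y‖ * (C₂ * (B * (6 * r)⁻¹ ^ (i.2 + 1))) := by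
          refine (norm_mul_le _ _).trans (mul_le_mul ((norm_mul_le _ _).trans ?_)
            (hC₂' _ _ (h.taylorBound₂ i.1.1.1.2 i.1.2 i.2)) (norm_nonneg _) (by positivity))
          exact mul_le_mul_of_nonneg_right (hC₁' _ _ (h.taylorBound₁ (p.measurableSet_cell _)
            (fun ξ hξ => norm_sub_le_of_mem_cell hp hξ) i.1.2 i.2)) (norm_nonneg _)
      _ = _ := by ring
  have := hs.hasSum_prod_fintype fun j => hg j.1 j.2
  convert! this using 1
  have hsum : ∑ a : p.tags, D₁.E.proj (p.cell (a : spectrum ℂ X₁)) = 1 := by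
    rw [Finset.sum_coe_sort p.tags fun a => D₁.E.proj (p.cell a)]
    exact D₁.E.sum_proj_cell p
  simp only [Fintype.sum_prod_type, Fintype.sum_bool, cond_true, cond_false]
  rw [Finset.sum_add_distrib, ← Finset.mul_sum, Finset.sum_neg_distrib, ← Finset.sum_mul, hsum,
    mul_one, one_mul, sub_eq_add_neg]

end DividedDiffDomain

end

/-! ### Values of the double operator integrals -/

instance TaggedPartition.neBot_atTop_prod {Ω Ω' : Type*} [MeasurableSpace Ω] [MeasurableSpace Ω'] :
    (atTop : Filter (TaggedPartition Ω × TaggedPartition Ω')).NeBot := by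
  rw [← prod_atTop_atTop_eq]
  infer_instance

section

variable {H : Type*} [NormedAddCommGroup H] [NormedSpace ℂ H] [CompleteSpace H] {X₁ X₂ : H →L[ℂ] H}
  {f : ℂ → ℂ} {r B : ℝ}

lemma SpectralDecomposition.partLimit_N_taylorCoeff {X : H →L[ℂ] H} (D : SpectralDecomposition X)
    (hr : 0 < r) (hf : BoundedHolomorphicNear (spectrum ℂ X) r f) :
    D.partLimit SpectralPart.N (taylorCoeff (spectrum ℂ X) f)
      = D.calculus D.nilPart f - D.calculus 0 f := by
  obtain ⟨M, hM⟩ := hf.exists_taylorBound hr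
  rw [SpectralDecomposition.calculus, ← D.partLimit_P_add_partLimit_N hr hM, D.partLimit_P,
    SpectralDecomposition.calculus, add_sub_cancel_left]

lemma SpectralDecomposition.partLimit_P_one {X : H →L[ℂ] H} (D : SpectralDecomposition X) :
    D.partLimit SpectralPart.P (taylorCoeff (spectrum ℂ X) fun _ => 1) = 1 := by
  rw [D.partLimit_P]
  exact (D.calculus_const 0 1).trans (one_smul _ _)

/-- `T_{f(x₁)}^{X_{1,N}, X_{2,P}}(I) = f(X₁) - f(X_{1,P})`. -/
lemma tendsto_doubleSum_comp_fst (D₁ : SpectralDecomposition X₁) (D₂ : SpectralDecomposition X₂)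
    (hr : 0 < r) (hf : BoundedHolomorphicNear (spectrum ℂ X₁) r f) :
    Tendsto (doubleSum D₁ D₂ (D₁.exponents SpectralPart.N) (D₂.exponents SpectralPart.P)
      (fun x₁ _ => f x₁) 1) atTop (𝓝 (D₁.calculus D₁.nilPart f - D₁.calculus 0 f)) := by
  obtain ⟨M, hM⟩ := hf.exists_taylorBound hr
  obtain ⟨K, hK⟩ := (BoundedHolomorphicNear.const (K := spectrum ℂ X₂) (r := r) 1).exists_taylorBound
    hr
  have := tendsto_doubleSum D₁ D₂ SpectralPart.N SpectralPart.P (fun x₁ _ => f x₁) 1 hr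
    (ι := Unit) (fun _ => hM) (fun _ => hK) (Summable.of_finite) fun ξ₁ ξ₂ q₁ _ q₂ hq₂ => by
      obtain rfl : q₂ = 0 := by simpa [SpectralDecomposition.exponents] using hq₂
      convert! hasSum_fintype (α := ℂ) (β := Unit) _ using 1
      simp [mixedDeriv, taylorCoeff]
  rwa [tsum_fintype, Finset.univ_unique, Finset.sum_singleton, D₁.partLimit_N_taylorCoeff hr hf,
    D₂.partLimit_P_one, mul_one, mul_one] at this

/-- `T_{f(x₂)}^{X_{1,P}, X_{2,N}}(I) = f(X₂) - f(X_{2,P})`. -/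
lemma tendsto_doubleSum_comp_snd (D₁ : SpectralDecomposition X₁) (D₂ : SpectralDecomposition X₂)
    (hr : 0 < r) (hf : BoundedHolomorphicNear (spectrum ℂ X₂) r f) :
    Tendsto (doubleSum D₁ D₂ (D₁.exponents SpectralPart.P) (D₂.exponents SpectralPart.N)
      (fun _ x₂ => f x₂) 1) atTop (𝓝 (D₂.calculus D₂.nilPart f - D₂.calculus 0 f)) := by
  obtain ⟨M, hM⟩ := hf.exists_taylorBound hr
  obtain ⟨K, hK⟩ := (BoundedHolomorphicNear.const (K := spectrum ℂ X₁) (r := r) 1).exists_taylorBound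
    hr
  have := tendsto_doubleSum D₁ D₂ SpectralPart.P SpectralPart.N (fun _ x₂ => f x₂) 1 hr
    (ι := Unit) (fun _ => hK) (fun _ => hM) (Summable.of_finite) fun ξ₁ ξ₂ q₁ hq₁ q₂ _ => by
      obtain rfl : q₁ = 0 := by simpa [SpectralDecomposition.exponents] using hq₁
      convert! hasSum_fintype (α := ℂ) (β := Unit) _ using 1
      simp [mixedDeriv, taylorCoeff]
  rwa [tsum_fintype, Finset.univ_unique, Finset.sum_singleton, D₂.partLimit_N_taylorCoeff hr hf,
    D₁.partLimit_P_one, mul_one, one_mul] at this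

namespace DividedDiffDomain

variable {p : TaggedPartition (spectrum ℂ X₁)}

lemma tendsto_doubleSum (D₁ : SpectralDecomposition X₁) (D₂ : SpectralDecomposition X₂)
    (h : DividedDiffDomain f (spectrum ℂ X₁) (spectrum ℂ X₂) r B)
    (hp : ∀ ξ : spectrum ℂ X₁, ‖(ξ : ℂ) - p.tag ξ‖ ≤ r) (a b : SpectralPart) (Y : H →L[ℂ] H) :
    Tendsto (doubleSum D₁ D₂ (D₁.exponents a) (D₂.exponents b) (dividedDiff f) Y) atTop
      (𝓝 (∑' i, D₁.partLimit a (dividedDiffCoeff₁ f p i) * Y *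
        D₂.partLimit b (dividedDiffCoeff₂ (spectrum ℂ X₂) f p i))) :=
  _root_.tendsto_doubleSum D₁ D₂ a b (dividedDiff f) Y h.r_pos
    (fun i => h.taylorBound₁ (p.measurableSet_cell _)
      (fun _ hξ => norm_sub_le_of_mem_cell hp hξ) i.1.2 i.2)
    (fun i => h.taylorBound₂ i.1.1.1.2 i.1.2 i.2) (h.summable_bound_prod (p.tags × Bool))
    fun ξ₁ ξ₂ q₁ _ q₂ _ => h.hasSum_mixedDeriv_dividedDiff p hp ξ₁ ξ₂ q₁ q₂

/-- `T_{f^{[1]}}^{X_{1,P}, X_{2,P}}(X_{1,P} - X_{2,P}) = f(X_{1,P}) - f(X_{2,P})`. -/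
lemma partDOI_P_P (D₁ : SpectralDecomposition X₁) (D₂ : SpectralDecomposition X₂)
    (h : DividedDiffDomain f (spectrum ℂ X₁) (spectrum ℂ X₂) r B)
    (hp : ∀ ξ : spectrum ℂ X₁, ‖(ξ : ℂ) - p.tag ξ‖ ≤ r) :
    partDOI D₁ D₂ SpectralPart.P SpectralPart.P (dividedDiff f) (D₁.projPart - D₂.projPart)
      = D₁.calculus 0 f - D₂.calculus 0 f := by
  rw [partDOI, (h.tendsto_doubleSum D₁ D₂ hp _ _ _).limUnder_eq]
  have := h.hasSum_powerIntegral D₁ D₂ p hp D₁.E.commutingQuasinilpotent_zero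
    D₂.E.commutingQuasinilpotent_zero
  rw [add_zero, add_zero] at this
  rw [← this.tsum_eq]
  simp only [SpectralDecomposition.partLimit_P]

/-- `T_{f^{[1]}}^{X₁, X₂}(X₁ - X₂) = f(X₁) - f(X₂)`. -/
lemma gdoi_eq (D₁ : SpectralDecomposition X₁) (D₂ : SpectralDecomposition X₂)
    (h : DividedDiffDomain f (spectrum ℂ X₁) (spectrum ℂ X₂) r B)
    (hp : ∀ ξ : spectrum ℂ X₁, ‖(ξ : ℂ) - p.tag ξ‖ ≤ r) :
    gdoi D₁ D₂ (dividedDiff f) (X₁ - X₂)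
      = D₁.calculus D₁.nilPart f - D₂.calculus D₂.nilPart f := by
  have hd := fun i : (p.tags × Bool) × ℕ => h.taylorBound₁ (p.measurableSet_cell i.1.1.1)
    (fun _ hξ => norm_sub_le_of_mem_cell hp hξ) i.1.2 i.2
  have he := fun i : (p.tags × Bool) × ℕ => h.taylorBound₂ i.1.1.1.2 i.1.2 i.2
  have hs := fun a b : SpectralPart => summable_partLimit_mul_partLimit D₁ D₂ a b (X₁ - X₂) h.r_pos
    hd he (h.summable_bound_prod (p.tags × Bool))
  have hl := fun a b : SpectralPart => (h.tendsto_doubleSum D₁ D₂ hp a b (X₁ - X₂)).limUnder_eq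
  have main := h.hasSum_powerIntegral D₁ D₂ p hp D₁.commutingQuasinilpotent_nilPart
    D₂.commutingQuasinilpotent_nilPart
  rw [D₁.projPart_add_nilPart, D₂.projPart_add_nilPart] at main
  rw [gdoi, partDOI, partDOI, partDOI, partDOI, hl, hl, hl, hl]
  refine HasSum.unique ((((hs _ _).hasSum.add (hs _ _).hasSum).add (hs _ _).hasSum).add
    (hs _ _).hasSum) ?_
  convert! main using 1
  ext1 i
  have e₁ := D₁.partLimit_P_add_partLimit_N h.r_pos (hd i)
  have e₂ := D₂.partLimit_P_add_partLimit_N h.r_pos (he i)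
  refine Eq.trans ?_ (congrArg₂ (fun S T => S * (X₁ - X₂) * T) e₁ e₂)
  noncomm_ring

end DividedDiffDomain

end

theorem mainTheorem9 {H : Type*} [NormedAddCommGroup H] [NormedSpace ℂ H] [CompleteSpace H]
    (R : ℝ) (f : ℂ → ℂ) (hf : AnalyticOnNhd ℂ f (Metric.ball 0 R))
    (X₁ X₂ : H →L[ℂ] H) (D₁ : SpectralDecomposition X₁) (D₂ : SpectralDecomposition X₂)
    (h₁ : ∀ z ∈ spectrum ℂ X₁, ‖z‖ < R) (h₂ : ∀ z ∈ spectrum ℂ X₂, ‖z‖ < R)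
    (hne : ∀ z₁ ∈ spectrum ℂ X₁, ∀ z₂ ∈ spectrum ℂ X₂, z₁ ≠ z₂) :
    -- the integrals defining the projection and nilpotent parts converge, and the parts add up
    ((D₁.E.Integrable fun z => (z : ℂ) • (1 : H →L[ℂ] H)) ∧
      (D₁.E.Integrable fun z => X₁ - (z : ℂ) • (1 : H →L[ℂ] H)) ∧
      X₁ = D₁.projPart + D₁.nilPart) ∧
    ((D₂.E.Integrable fun z => (z : ℂ) • (1 : H →L[ℂ] H)) ∧
      (D₂.E.Integrable fun z => X₂ - (z : ℂ) • (1 : H →L[ℂ] H)) ∧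
      X₂ = D₂.projPart + D₂.nilPart) ∧
    -- all the double operator integrals in the formula converge
    GDOIConverges D₁ D₂ (dividedDiff f) (X₁ - X₂) ∧
    PartDOIConverges D₁ D₂ SpectralPart.P SpectralPart.P (dividedDiff f) (D₁.projPart - D₂.projPart) ∧
    PartDOIConverges D₁ D₂ SpectralPart.N SpectralPart.P (fun x₁ _ => f x₁) 1 ∧
    PartDOIConverges D₁ D₂ SpectralPart.P SpectralPart.N (fun _ x₂ => f x₂) 1 ∧
    -- the formula
    gdoi D₁ D₂ (dividedDiff f) (X₁ - X₂) =
      partDOI D₁ D₂ SpectralPart.P SpectralPart.P (dividedDiff f) (D₁.projPart - D₂.projPart) +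
        (partDOI D₁ D₂ SpectralPart.N SpectralPart.P (fun x₁ _ => f x₁) 1 -
          partDOI D₁ D₂ SpectralPart.P SpectralPart.N (fun _ x₂ => f x₂) 1) := by
  have hf' : DifferentiableOn ℂ f (Metric.ball 0 R) := hf.differentiableOn
  obtain ⟨r, B, h⟩ := exists_dividedDiffDomain Metric.isOpen_ball hf' (spectrum.isCompact X₁)
    (spectrum.isCompact X₂) (fun z hz => mem_ball_zero_iff.2 (h₁ z hz))
    (fun z hz => mem_ball_zero_iff.2 (h₂ z hz))
    (Set.disjoint_left.2 fun z hz hz' => hne z hz z hz' rfl)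
  obtain ⟨p, hp'⟩ := (SpectralDecomposition.boundedMeasurable_coe X₁).exists_dist_le h.r_pos
  have hp : ∀ ξ : spectrum ℂ X₁, ‖(ξ : ℂ) - p.tag ξ‖ ≤ r := fun ξ => hp' _ _ (p.tag_tag ξ).symm
  have hNP := tendsto_doubleSum_comp_fst D₁ D₂ h.r_pos h.boundedHolomorphicNear₁
  have hPN := tendsto_doubleSum_comp_snd D₁ D₂ h.r_pos h.boundedHolomorphicNear₂
  refine ⟨⟨⟨_, D₁.tendsto_riemannSum_projPart⟩, ⟨_, D₁.tendsto_riemannSum_nilPart⟩,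
      D₁.projPart_add_nilPart.symm⟩,
    ⟨⟨_, D₂.tendsto_riemannSum_projPart⟩, ⟨_, D₂.tendsto_riemannSum_nilPart⟩,
      D₂.projPart_add_nilPart.symm⟩,
    fun a b => ⟨_, h.tendsto_doubleSum D₁ D₂ hp a b _⟩, ⟨_, h.tendsto_doubleSum D₁ D₂ hp _ _ _⟩,
    ⟨_, hNP⟩, ⟨_, hPN⟩, ?_⟩
  rw [h.gdoi_eq D₁ D₂ hp, h.partDOI_P_P D₁ D₂ hp, partDOI, partDOI, hNP.limUnder_eq,
    hPN.limUnder_eq]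
  abel
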